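/- For a finite poset $S=\{s_1,\dots,s_n\}$ let $f_S(x)=\sum_{s_i\le s_j}x_ix_j$ (the sum over all pairs $(i,j)$ with $s_i\le s_j$, including $i=j$), let $P_n=\{x\in\mathbb R^n : x_i>0\ \text{for all } i,\ x_1+\dots+x_n=1\}$, $\overline P_n=\{x\in\mathbb R^n : x_i\ge 0\ \text{for all } i,\ x_1+\dots+x_n=1\}$, and put $P(S)=\bigl(\inf_{x\in\overline P_n}f_S(x)\bigr)^{-1}$. The poset $S$ is called $P$-faithful if there is $u\in P_n$ such that $f_S(u)>0$, $f_S(u)\le f_S(w)$ for all $w\in\overline P_n$, and $f_S(u)<f_S(w)$ for all $w\in\overline P_n\setminus P_n$. It is called utmost if it is $P$-faithful, $P(S)\ge 4$, and $P(S')\le 4$ for every nonempty proper subset $S'\subset S$ (with the induced order). Write $\sqcup$ for the disjoint union of posets in which elements of different parts are incomparable, $Z_m$ for the chain with $m$ elements, and $(n_1,\dots,n_p)=Z_{n_1}\sqcup\dots\sqcup Z_{n_p}$; posets of this form are called primitive. Let $K$ be the poset with four elements $a,b,c,d$ whose only strict relations are $a<b$, $c<d$ and $a<d$. Consider the two lists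 (I) $(1,1,1,1)$, $(2,2,2)$, $(1,3,3)$, $(1,2,5)$, $K\sqcup Z_4$; (II) $(1,1,1,1,1)$, $(1,1,1,2)$, $(2,2,3)$, $(1,3,4)$, $(1,2,6)$, $K\sqcup Z_5$. Then a finite poset $S$ is utmost if and only if it is isomorphic to one of the posets in the lists (I) and (II). Moreover, a utmost poset $S$ that is not primitive is isomorphic to $K\sqcup Z_4$ or to $K\sqcup Z_5$. -/

import Mathlib

open scoped BigOperators

/-- The set `P_n`: vectors with strictly positive coordinates and coordinate sum `1`. Its closure
`P̄_n` is `stdSimplex ℝ ι` (for a nonempty finite index set `ι`). -/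
def posSimplex (ι : Type*) [Fintype ι] : Set (ι → ℝ) :=
  {x | (∀ i, 0 < x i) ∧ ∑ i, x i = 1}

/-- `u ∈ P_n` is a `P`-faithful vector for `f`: the value `f u` is positive and minimal on `P̄_n`,
and it is not attained on `P̄_n \ P_n`. -/
def IsPFaithfulVector {ι : Type*} [Fintype ι] (f : (ι → ℝ) → ℝ) (u : ι → ℝ) : Prop :=
  u ∈ posSimplex ι ∧ 0 < f u ∧
    ∀ w ∈ stdSimplex ℝ ι, f u ≤ f w ∧ (w ∉ posSimplex ι → f u < f w)

open Classical in
/-- The quadratic form `f_S(x) = ∑_{s ≤ t} x_s x_t` of a finite poset `S`; the sum runs over all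
ordered pairs `(s, t)` with `s ≤ t`, including `s = t`. -/
noncomputable def posetForm (S : Type*) [Fintype S] [PartialOrder S] (x : S → ℝ) : ℝ :=
  ∑ s, ∑ t, if s ≤ t then x s * x t else 0

/-- A finite poset is `P`-faithful if its quadratic form has a `P`-faithful vector. -/
def PFaithful (S : Type*) [Fintype S] [PartialOrder S] : Prop :=
  ∃ u : S → ℝ, IsPFaithfulVector (posetForm S) u

/-- The norm `‖S, ≤‖`: the infimum of `f_S` over `P̄_n`. -/
noncomputable def posetNorm (S : Type*) [Fintype S] [PartialOrder S] : ℝ :=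
  sInf (posetForm S '' stdSimplex ℝ S)

/-- `P(S) = ‖S, ≤‖⁻¹`. -/
noncomputable def posetP (S : Type*) [Fintype S] [PartialOrder S] : ℝ :=
  (posetNorm S)⁻¹

/-- `S` is utmost: it is `P`-faithful, `P(S) ≥ 4`, and `P(S') ≤ 4` for all (nonempty) proper
subsets `S'` of `S` with the induced order. -/
def Utmost (S : Type*) [Fintype S] [PartialOrder S] : Prop :=
  PFaithful S ∧ 4 ≤ posetP S ∧
    ∀ T : Finset S, T.Nonempty → T ⊂ Finset.univ → posetP T ≤ 4

/-- The primitive poset `(n_1, …, n_p)`: the disjoint union of chains with `n_1, …, n_p` elements,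
elements of different chains being incomparable. -/
abbrev ChainUnion {p : ℕ} (n : Fin p → ℕ) : Type := Σ i : Fin p, Fin (n i)

/-- A poset is primitive if it is a disjoint union of finitely many finite chains. -/
def Primitive (S : Type*) [PartialOrder S] : Prop :=
  ∃ (p : ℕ) (n : Fin p → ℕ), Nonempty (S ≃o ChainUnion n)

/-- The four-element poset `K = ⟨2; 2⟩`: two chains `0 < 1` and `2 < 3`, together with the single
relation `0 < 3` (the minimal point of the first chain is below the maximal point of the
second). -/
def KPoset : Type := Fin 4

instance : Fintype KPoset := inferInstanceAs (Fintype (Fin 4))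

/-- The order relation of `K`. -/
def KPoset.rel (a b : Fin 4) : Prop :=
  a = b ∨ (a = 0 ∧ b = 1) ∨ (a = 2 ∧ b = 3) ∨ (a = 0 ∧ b = 3)

instance : DecidableRel KPoset.rel := fun a b =>
  inferInstanceAs (Decidable (a = b ∨ (a = 0 ∧ b = 1) ∨ (a = 2 ∧ b = 3) ∨ (a = 0 ∧ b = 3)))

instance : PartialOrder KPoset where
  le := KPoset.rel
  le_refl _ := Or.inl rfl
  le_trans := (by decide : ∀ a b c : Fin 4, KPoset.rel a b → KPoset.rel b c → KPoset.rel a c)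
  le_antisymm := (by decide : ∀ a b : Fin 4, KPoset.rel a b → KPoset.rel b a → a = b)

/-- `K ⊔ Z_m`: the disjoint union of `K` and a chain with `m` elements, elements of the two parts
being incomparable. -/
abbrev KWithChain (m : ℕ) : Type := KPoset ⊕ Fin m

/-- `S` is (isomorphic to) one of the posets of list I. -/
def InListI (S : Type*) [PartialOrder S] : Prop :=
  Nonempty (S ≃o ChainUnion ![1, 1, 1, 1]) ∨
  Nonempty (S ≃o ChainUnion ![2, 2, 2]) ∨
  Nonempty (S ≃o ChainUnion ![1, 3, 3]) ∨
  Nonempty (S ≃o ChainUnion ![1, 2, 5]) ∨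
  Nonempty (S ≃o KWithChain 4)

/-- `S` is (isomorphic to) one of the posets of list II. -/
def InListII (S : Type*) [PartialOrder S] : Prop :=
  Nonempty (S ≃o ChainUnion ![1, 1, 1, 1, 1]) ∨
  Nonempty (S ≃o ChainUnion ![1, 1, 1, 2]) ∨
  Nonempty (S ≃o ChainUnion ![2, 2, 3]) ∨
  Nonempty (S ≃o ChainUnion ![1, 3, 4]) ∨
  Nonempty (S ≃o ChainUnion ![1, 2, 6]) ∨
  Nonempty (S ≃o KWithChain 5)

/-! Up to scaling, a `P`-faithful vector is a positive `v` at which every coordinate of the gradient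
of the form equals 1, and then `∑ v = P(S) / 2`. Since the gradient (`row`) and the form depend only
on the comparability graph, most of the classification is carried out in that graph; the order
returns when cycles must be excluded and when isomorphisms are built.

The engine is `UtmostData.cover_or_grow`. Let `y ≥ 0` have gradient 1 on its own support. If the
support is all of `S`, symmetry of the bilinear form gives `∑ y = ∑ v ≥ 2`. Otherwise `y` lies on
the boundary, so `∑ y ≤ 2`, and strict minimality at `v` produces a point `s` outside the support
where the gradient of `y` is less than 1. Such an `s` has few neighbours in the support.

Antichains of size at least four are settled by weights 1/2 on the points. In width three, take
three mutually incomparable chains of least `tripleCost`, that is, of largest `P`. If they fill `S`,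
arithmetic gives the primitive posets with three chains. If not, the new point `s` is comparable
with a whole chain, since no four-element antichain exists, and minimality leaves two patterns: a
four-point path with a separate chain, which `KConfig.cover` identifies with `K ⊔ Z_4` or `K ⊔ Z_5`,
and two triangles joined by an edge plus a point, which `UtmostData.not_triangles` excludes. The
auxiliary configurations on the way are excluded by applying the same engine to explicit rational
weights.

Conversely, the sharp constant in `(∑ x)² ≤ p f(x)` is additive over disjoint unions by
Cauchy–Schwarz, so it suffices to know the constants, in the interior and on the boundary, for
chains and for `K`. -/

namespace PosetNorm

open Finset

/-- Comparability of two elements (every element is comparable to itself). -/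
def Compar {S : Type*} [PartialOrder S] (s t : S) : Prop := s ≤ t ∨ t ≤ s

lemma Compar.refl {S : Type*} [PartialOrder S] (s : S) : Compar s s := Or.inl le_rfl

lemma Compar.symm {S : Type*} [PartialOrder S] {s t : S} (h : Compar s t) : Compar t s := Or.symm h

lemma compar_comm {S : Type*} [PartialOrder S] {s t : S} : Compar s t ↔ Compar t s :=
  ⟨Compar.symm, Compar.symm⟩

/-! ### The quadratic form, its gradient, and homogeneous forms of the bounds on `P` -/

section Form

set_option linter.unusedSectionVars false

variable {S : Type*} [Fintype S] [PartialOrder S]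

open Classical in
/-- The `s`-th coordinate of the gradient of the quadratic form of `S` at `x`. -/
noncomputable def row (x : S → ℝ) (s : S) : ℝ :=
  x s + ∑ t, if Compar s t then x t else 0

/-- Euler's identity for a quadratic form. A diagonal pair satisfies both `s ≤ t` and `t ≤ s`, which
accounts for the extra `x s` in `row`. -/
lemma two_mul_posetForm (x : S → ℝ) : 2 * posetForm S x = ∑ s, x s * row x s := by
  classical
  have h1 : posetForm S x = ∑ s, ∑ t, if s ≤ t then x s * x t else 0 := by
    unfold posetForm; congr!
  have h2 : posetForm S x = ∑ s, ∑ t, if t ≤ s then x s * x t else 0 := by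
    rw [h1, Finset.sum_comm]
    refine sum_congr rfl fun s _ => sum_congr rfl fun t _ => ?_
    rw [mul_comm]
  have h3 : ∀ s, x s * row x s = (∑ t, if s ≤ t then x s * x t else 0) +
      ∑ t, if t ≤ s then x s * x t else 0 := by
    intro s
    have : x s = ∑ t, if s = t then x t else 0 := by simp
    rw [row, this, ← sum_add_distrib, ← sum_add_distrib, ← this, mul_sum]
    refine sum_congr rfl fun t _ => ?_
    by_cases hst : s = t
    · subst hst; simp [Compar]; ring
    · by_cases h : s ≤ t
      · have : ¬ t ≤ s := fun h' => hst (le_antisymm h h')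
        simp [Compar, h, this, hst]
      · by_cases h' : t ≤ s <;> simp [Compar, h, h', hst]
  rw [two_mul]
  nth_rewrite 1 [h1]
  rw [h2, ← sum_add_distrib]
  exact sum_congr rfl fun s _ => (h3 s).symm

/-- Symmetry of the associated bilinear form; it is what allows the faithful vector to be compared
with test vectors. -/
lemma sum_mul_row_comm (x y : S → ℝ) : ∑ s, x s * row y s = ∑ s, y s * row x s := by
  classical
  simp only [row, mul_add, sum_add_distrib, mul_sum]
  congr 1
  · exact sum_congr rfl fun s _ => mul_comm _ _
  · rw [sum_comm]
    refine sum_congr rfl fun s _ => sum_congr rfl fun t _ => ?_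
    by_cases h : Compar t s
    · simp [h, h.symm, mul_comm]
    · have h' : ¬ Compar s t := fun h' => h h'.symm
      simp [h, h']

lemma row_add_smul (x y : S → ℝ) (c : ℝ) (s : S) :
    row (fun t => x t + c * y t) s = row x s + c * row y s := by
  classical
  simp only [row, mul_add, mul_sum]
  have : (∑ t, if Compar s t then x t + c * y t else 0) =
      (∑ t, if Compar s t then x t else 0) + ∑ t, c * (if Compar s t then y t else 0) := by
    rw [← sum_add_distrib]
    exact sum_congr rfl fun t _ => by by_cases h : Compar s t <;> simp [h]
  rw [this]; ring

lemma posetForm_add_smul (x y : S → ℝ) (c : ℝ) :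
    posetForm S (fun t => x t + c * y t) =
      posetForm S x + c * ∑ s, y s * row x s + c ^ 2 * posetForm S y := by
  have h := two_mul_posetForm (fun t => x t + c * y t)
  simp only [row_add_smul] at h
  have e : ∑ s, (x s + c * y s) * (row x s + c * row y s) =
      ∑ s, x s * row x s + c * ∑ s, x s * row y s + c * ∑ s, y s * row x s +
        c ^ 2 * ∑ s, y s * row y s := by
    simp only [mul_sum, ← sum_add_distrib]
    exact sum_congr rfl fun s _ => by ring
  rw [e, sum_mul_row_comm x y, ← two_mul_posetForm, ← two_mul_posetForm] at h
  linarith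

lemma posetForm_smul (c : ℝ) (x : S → ℝ) :
    posetForm S (fun s => c * x s) = c ^ 2 * posetForm S x := by
  have h0 : posetForm S (fun _ : S => (0:ℝ)) = 0 := by simp [posetForm]
  have := posetForm_add_smul (fun _ => 0) x c
  simpa [row, h0] using this

lemma posetForm_nonneg {x : S → ℝ} (hx : ∀ s, 0 ≤ x s) : 0 ≤ posetForm S x := by
  unfold posetForm
  refine sum_nonneg fun s _ => sum_nonneg fun t _ => ?_
  split_ifs
  · exact mul_nonneg (hx s) (hx t)
  · exact le_rfl

lemma sum_sq_le_posetForm {x : S → ℝ} (hx : ∀ s, 0 ≤ x s) : ∑ s, x s ^ 2 ≤ posetForm S x := by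
  classical
  have h : posetForm S x = ∑ s, ∑ t, if s ≤ t then x s * x t else 0 := by
    unfold posetForm; congr!
  rw [h]
  refine sum_le_sum fun s _ => ?_
  refine le_trans ?_ (single_le_sum (a := s) (f := fun t => if s ≤ t then x s * x t else 0)
    (fun t _ => ?_) (mem_univ s))
  · simp [sq]
  · split_ifs
    · exact mul_nonneg (hx s) (hx t)
    · exact le_rfl

lemma sq_sum_le_card_mul_posetForm {x : S → ℝ} (hx : ∀ s, 0 ≤ x s) :
    (∑ s, x s) ^ 2 ≤ Fintype.card S * posetForm S x := by
  refine (sq_sum_le_card_mul_sum_sq (s := univ) (f := x)).trans ?_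
  rw [card_univ]
  exact mul_le_mul_of_nonneg_left (sum_sq_le_posetForm hx) (by positivity)

lemma bddBelow_posetForm : BddBelow (posetForm S '' stdSimplex ℝ S) := by
  refine ⟨0, ?_⟩
  rintro _ ⟨x, hx, rfl⟩
  exact posetForm_nonneg hx.1

lemma normalize_mem_stdSimplex {x : S → ℝ} (hx : ∀ s, 0 ≤ x s) (h : 0 < ∑ s, x s) :
    (fun s => (∑ t, x t)⁻¹ * x s) ∈ stdSimplex ℝ S := by
  refine ⟨fun s => mul_nonneg (inv_nonneg.2 h.le) (hx s), ?_⟩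
  rw [← mul_sum, inv_mul_cancel₀ h.ne']

lemma stdSimplex_nonempty [Nonempty S] : (stdSimplex ℝ S).Nonempty := by
  obtain ⟨s⟩ := ‹Nonempty S›
  classical
  exact ⟨_, single_mem_stdSimplex ℝ s⟩

/-- For nonempty `S`, the inequality `P(S) ≤ c` is a lower bound for the quadratic form. -/
lemma posetP_le_iff [Nonempty S] {c : ℝ} (hc : 0 < c) :
    posetP S ≤ c ↔ ∀ x : S → ℝ, (∀ s, 0 ≤ x s) → (∑ s, x s) ^ 2 ≤ c * posetForm S x := by
  have hpos : 0 < posetNorm S := by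
    have hn : (0 : ℝ) < Fintype.card S := by exact_mod_cast Fintype.card_pos
    refine lt_of_lt_of_le (inv_pos.2 hn) (le_csInf (stdSimplex_nonempty.image _) ?_)
    rintro _ ⟨x, hx, rfl⟩
    have := sq_sum_le_card_mul_posetForm hx.1
    rw [hx.2] at this
    rw [inv_le_iff_one_le_mul₀ hn]
    linarith
  rw [posetP, inv_le_iff_one_le_mul₀ hpos]
  constructor
  · intro h x hx
    rcases (sum_nonneg fun s _ => hx s : 0 ≤ ∑ s, x s).eq_or_lt with h0 | h0
    · rw [← h0]
      simpa using mul_nonneg hc.le (posetForm_nonneg hx)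
    · have h1 : posetNorm S ≤ _ :=
        csInf_le bddBelow_posetForm ⟨_, normalize_mem_stdSimplex hx h0, rfl⟩
      rw [posetForm_smul, inv_pow, inv_mul_eq_div, le_div_iff₀ (by positivity)] at h1
      nlinarith [sq_nonneg (∑ s, x s)]
  · intro h
    have : c⁻¹ ≤ posetNorm S := by
      refine le_csInf (stdSimplex_nonempty.image _) ?_
      rintro _ ⟨x, hx, rfl⟩
      have := h x hx.1
      rw [hx.2] at this
      rw [inv_le_iff_one_le_mul₀ hc]
      linarith
    rw [inv_le_iff_one_le_mul₀ hc] at this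
    linarith

open Classical in
lemma posetForm_subset (T : Finset S) (x : S → ℝ) (hx : ∀ s ∉ T, x s = 0) :
    posetForm T (fun t => x t) = posetForm S x := by
  have key : ∀ f : S → ℝ, (∀ s ∉ T, f s = 0) → ∑ t : T, f t = ∑ s, f s := by
    intro f hf
    rw [Finset.sum_coe_sort T f]
    exact sum_subset (subset_univ T) fun s _ hs => hf s hs
  unfold posetForm
  rw [← key]
  · refine sum_congr rfl fun s _ => ?_
    rw [← key]
    · rfl
    · intro t ht; simp [hx t ht]
  · intro s hs; simp [hx s hs]

lemma sum_subset_coe (T : Finset S) (x : S → ℝ) (hx : ∀ s ∉ T, x s = 0) :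
    ∑ t : T, x t = ∑ s, x s := by
  rw [Finset.sum_coe_sort T x]
  exact sum_subset (subset_univ T) fun s _ hs => hx s hs

/-- `P(T) ≤ c` for every nonempty proper subset, in terms of the form of `S`. -/
lemma posetP_subset_le_iff {c : ℝ} (hc : 0 < c) :
    (∀ T : Finset S, T.Nonempty → T ⊂ univ → posetP T ≤ c) ↔
      ∀ x : S → ℝ, (∀ s, 0 ≤ x s) → (∃ s, x s = 0) →
        (∑ s, x s) ^ 2 ≤ c * posetForm S x := by
  classical
  constructor
  · rintro h x hx ⟨s, hs⟩
    rcases (univ.erase s).eq_empty_or_nonempty with he | hne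
    · have : ∑ t, x t = 0 := by
        rw [← add_sum_erase _ _ (mem_univ s), he, hs]; simp
      rw [this]
      simpa using mul_nonneg hc.le (posetForm_nonneg hx)
    · have hx0 : ∀ t ∉ univ.erase s, x t = 0 := by
        intro t ht
        have : t = s := by simpa using ht
        rw [this, hs]
      have : Nonempty (univ.erase s : Finset S) := hne.to_subtype
      have := (posetP_le_iff hc).1 (h _ hne (erase_ssubset (mem_univ s)))
        (fun t => x t) (fun t => hx t)
      rwa [posetForm_subset _ _ hx0, sum_subset_coe _ _ hx0] at this
  · intro h T hT hTS
    have : Nonempty T := hT.to_subtype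
    rw [posetP_le_iff hc]
    intro x hx
    obtain ⟨s, -, hs⟩ := exists_of_ssubset hTS
    set z : S → ℝ := fun t => if ht : t ∈ T then x ⟨t, ht⟩ else 0 with hz
    have hx0 : ∀ t ∉ T, z t = 0 := fun t ht => by simp [hz, ht]
    have hzx : (fun t : T => z t) = x := by ext t; simp [hz]
    have := h z (fun t => by
      by_cases ht : t ∈ T
      · simpa [hz, ht] using hx ⟨t, ht⟩
      · simp [hz, ht]) ⟨s, hx0 s hs⟩
    rwa [← posetForm_subset T z hx0, ← sum_subset_coe T z hx0, hzx] at this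

end Form

/-! ### Minimizers and the growth alternative -/

section Extremal

set_option linter.unusedSectionVars false
set_option linter.unnecessarySeqFocus false

variable {S : Type*} [Fintype S] [PartialOrder S]

/-- The analytic content of being utmost: a positive solution `v` of `row v = 1` with coordinate sum
at least `2`, and the lower bounds for the form on the boundary of the positive cone. -/
structure UtmostData (v : S → ℝ) : Prop where
  pos : ∀ s, 0 < v s
  row_eq : ∀ s, row v s = 1
  two_le : 2 ≤ ∑ s, v s
  le_four : ∀ x : S → ℝ, (∀ s, 0 ≤ x s) → (∃ s, x s = 0) → (∑ s, x s) ^ 2 ≤ 4 * posetForm S x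
  lt_form : ∀ x : S → ℝ, (∀ s, 0 ≤ x s) → (∃ s, x s = 0) → 0 < ∑ s, x s →
    (∑ s, x s) ^ 2 < 2 * (∑ s, v s) * posetForm S x

/-- Lagrange condition: if the gradient were larger at `s` than at `t`, moving a little mass from
`s` to `t` would lower the form. -/
lemma row_eq_of_minimal {u : S → ℝ} (hu : u ∈ posSimplex S)
    (hmin : ∀ w ∈ stdSimplex ℝ S, posetForm S u ≤ posetForm S w) (s t : S) :
    row u s ≤ row u t := by
  classical
  by_cases hst : s = t
  · rw [hst]
  by_contra! hlt
  set d : S → ℝ := Pi.single t 1 - Pi.single s 1 with hd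
  have hdrow : ∑ r, d r * row u r = row u t - row u s := by
    simp [hd, sub_mul, sum_sub_distrib, Pi.single_apply]
  have hdsum : ∑ r, d r = 0 := by simp [hd, sum_sub_distrib]
  set q := posetForm S d
  -- The bound by `u s` keeps the perturbed vector in the simplex; the other bound makes the linear
  -- gain exceed the quadratic term `ε² q`, the `+ 1` giving strictness.
  obtain ⟨ε, hε, hεu, hεq⟩ : ∃ ε : ℝ, 0 < ε ∧ ε ≤ u s ∧ ε * (|q| + 1) ≤ row u s - row u t := by
    refine ⟨min (u s) ((row u s - row u t) / (|q| + 1)), lt_min (hu.1 s) ?_, min_le_left _ _, ?_⟩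
    · exact div_pos (sub_pos.2 hlt) (by positivity)
    · rw [← le_div_iff₀ (by positivity)]
      exact min_le_right _ _
  have hw : (fun r => u r + ε * d r) ∈ stdSimplex ℝ S := by
    constructor
    · intro r
      have := (hu.1 r).le
      simp only [hd, Pi.sub_apply, Pi.single_apply]
      split_ifs <;> subst_vars <;> simp_all <;> linarith
    · rw [sum_add_distrib, ← mul_sum, hdsum, hu.2]; simp
  have h := hmin _ hw
  rw [posetForm_add_smul, hdrow] at h
  have hq : q ≤ |q| := le_abs_self q
  nlinarith [mul_pos hε hε]

/-- At the minimizer all gradient coordinates equal `κ = 2 f(u)`; dividing by `κ` makes them 1 and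
the coordinate sum `κ⁻¹ = P(S) / 2`. -/
lemma exists_utmostData (h : Utmost S) : ∃ v : S → ℝ, UtmostData v := by
  obtain ⟨⟨u, hu, hfu, hmin⟩, hP, hsub⟩ := h
  have hrow : ∀ s, row u s = 2 * posetForm S u := by
    intro s
    have hc : ∀ t, row u t = row u s := fun t =>
      le_antisymm (row_eq_of_minimal hu (fun w hw => (hmin w hw).1) t s)
        (row_eq_of_minimal hu (fun w hw => (hmin w hw).1) s t)
    rw [two_mul_posetForm, sum_congr rfl fun t _ => by rw [hc t], ← sum_mul, hu.2, one_mul]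
  have husimp : u ∈ stdSimplex ℝ S := ⟨fun s => (hu.1 s).le, hu.2⟩
  have hnorm : posetNorm S = posetForm S u := by
    refine IsLeast.csInf_eq ⟨⟨u, husimp, rfl⟩, ?_⟩
    rintro _ ⟨w, hw, rfl⟩
    exact (hmin w hw).1
  set κ := 2 * posetForm S u with hκ
  have hκ0 : 0 < κ := by positivity
  have hsum : ∑ s, κ⁻¹ * u s = κ⁻¹ := by rw [← mul_sum, hu.2, mul_one]
  refine ⟨fun s => κ⁻¹ * u s, fun s => mul_pos (inv_pos.2 hκ0) (hu.1 s), fun s => ?_, ?_, ?_, ?_⟩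
  · have := row_add_smul (fun _ => 0) u κ⁻¹ s
    simp only [zero_add, hrow] at this
    rw [this, inv_mul_cancel₀ hκ0.ne']
    simp [row]
  · rw [hsum]
    rw [posetP, hnorm] at hP
    rw [hκ, mul_inv]
    linarith
  · exact (posetP_subset_le_iff (by norm_num)).1 hsub
  · rintro x hx ⟨s, hs⟩ hpos
    rw [hsum]
    have := (hmin _ (normalize_mem_stdSimplex hx hpos)).2 (fun h => by
      have := h.1 s
      simp [hs] at this)
    rw [posetForm_smul, inv_pow, inv_mul_eq_div, lt_div_iff₀ (by positivity)] at this
    rw [hκ, mul_inv, ← mul_assoc, mul_inv_cancel₀ two_ne_zero, one_mul, inv_mul_eq_div,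
      lt_div_iff₀ hfu]
    linarith

open Classical in
/-- The number of elements of `A` comparable with `s`. -/
noncomputable def comparCount (A : Finset S) (s : S) : ℕ := #{t ∈ A | Compar s t}

/-- The element `s` is not comparable to any element of `A`. -/
def Apart (s : S) (A : Finset S) : Prop := ∀ a ∈ A, ¬ Compar s a

lemma comparCount_eq_zero_iff {A : Finset S} {s : S} : comparCount A s = 0 ↔ Apart s A := by
  simp [comparCount, Apart, filter_eq_empty_iff]

open Classical in
lemma comparCount_le_card (A : Finset S) (s : S) : comparCount A s ≤ #A := card_filter_le _ _

lemma comparCount_eq_card_iff {A : Finset S} {s : S} :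
    comparCount A s = #A ↔ ∀ a ∈ A, Compar s a := by
  simp [comparCount, card_filter_eq_iff]

open Classical in
lemma comparCount_singleton (a s : S) :
    comparCount {a} s = if Compar s a then 1 else 0 := by
  simp only [comparCount, filter_singleton]
  split_ifs <;> simp

open Classical in
/-- The vector which is constant `w i` on the pairwise disjoint sets `F i`. -/
noncomputable def blockVec {ι : Type*} [Fintype ι] (w : ι → ℝ) (F : ι → Finset S) (s : S) : ℝ :=
  ∑ i, if s ∈ F i then w i else 0

section Block

variable {ι : Type*} [Fintype ι] {w : ι → ℝ} {F : ι → Finset S}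

lemma sum_blockVec_mul (w : ι → ℝ) (F : ι → Finset S) (z : S → ℝ) :
    ∑ s, blockVec w F s * z s = ∑ i, w i * ∑ s ∈ F i, z s := by
  classical
  simp only [blockVec, sum_mul]
  rw [sum_comm]
  refine sum_congr rfl fun i _ => ?_
  rw [mul_sum, ← sum_filter_add_sum_filter_not univ (· ∈ F i)]
  rw [filter_mem_eq_inter, univ_inter]
  have : ∑ s with s ∉ F i, (if s ∈ F i then w i else 0) * z s = 0 :=
    sum_eq_zero fun s hs => by simp [(mem_filter.1 hs).2]
  rw [this, add_zero]
  exact sum_congr rfl fun s hs => by simp [hs]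

lemma sum_blockVec (w : ι → ℝ) (F : ι → Finset S) : ∑ s, blockVec w F s = ∑ i, w i * #(F i) := by
  simpa using sum_blockVec_mul w F (fun _ => 1)

lemma row_blockVec (w : ι → ℝ) (F : ι → Finset S) (s : S) :
    row (blockVec w F) s = blockVec w F s + ∑ i, w i * comparCount (F i) s := by
  classical
  rw [row]
  congr 1
  have := sum_blockVec_mul w F (fun t => if Compar s t then 1 else 0)
  simp only [mul_ite, mul_one, mul_zero] at this
  rw [this]
  refine sum_congr rfl fun i _ => ?_
  simp [comparCount]

lemma blockVec_eq_zero {s : S} (h : ∀ i, s ∉ F i) : blockVec w F s = 0 := by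
  simp [blockVec, h]

lemma blockVec_of_mem (hF : ∀ i j, i ≠ j → Disjoint (F i) (F j)) {s : S} {i : ι} (h : s ∈ F i) :
    blockVec w F s = w i := by
  classical
  rw [blockVec, sum_eq_single i]
  · simp [h]
  · intro j _ hji
    simp [disjoint_left.1 (hF i j hji.symm) h]
  · simp

/-- Either the blocks fill `S`, or the weighted sum of block sizes is at most two, and some outside
element has small row value. -/
lemma UtmostData.cover_or_grow {v : S → ℝ} (hv : UtmostData v) (w : ι → ℝ) (F : ι → Finset S)
    (hw : ∀ i, 0 ≤ w i) (hF : ∀ i j, i ≠ j → Disjoint (F i) (F j))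
    (hrow : ∀ i, ∀ t ∈ F i, w i + ∑ j, w j * comparCount (F j) t = 1)
    (hpos : 0 < ∑ i, w i * #(F i)) :
    ((∀ s, ∃ i, s ∈ F i) ∧ 2 ≤ ∑ i, w i * #(F i)) ∨
      (∑ i, w i * #(F i) ≤ 2 ∧ ∃ s, (∀ i, s ∉ F i) ∧ ∑ i, w i * comparCount (F i) s < 1) := by
  set y := blockVec w F with hy
  have hysum : ∑ s, y s = ∑ i, w i * #(F i) := sum_blockVec w F
  have hy0 : ∀ s, 0 ≤ y s := fun s => by
    rw [hy, blockVec]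
    exact sum_nonneg fun i _ => by split_ifs <;> simp [hw]
  have hyrow : ∀ i, ∀ t ∈ F i, row y t = 1 := fun i t ht => by
    rw [hy, row_blockVec, blockVec_of_mem hF ht, hrow i t ht]
  -- Pairing `v` with `y` in both orders, using that `row v = 1`.
  have hvy : ∑ s, v s * row y s = ∑ i, w i * #(F i) := by
    rw [sum_mul_row_comm]; simp only [hv.row_eq, mul_one, hysum]
  by_cases hcov : ∀ s, ∃ i, s ∈ F i
  · left
    refine ⟨hcov, ?_⟩
    rw [← hvy]
    refine hv.two_le.trans (sum_le_sum fun s _ => ?_)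
    obtain ⟨i, hi⟩ := hcov s
    rw [hyrow i s hi, mul_one]
  · right
    push Not at hcov
    obtain ⟨s₀, hs₀⟩ := hcov
    have hform : 2 * posetForm S y = ∑ i, w i * #(F i) := by
      rw [two_mul_posetForm, ← hysum]
      refine sum_congr rfl fun s _ => ?_
      by_cases h : ∃ i, s ∈ F i
      · obtain ⟨i, hi⟩ := h
        rw [hyrow i s hi, mul_one]
      · push Not at h
        rw [hy, blockVec_eq_zero h, zero_mul]
    have hy₀ : ∃ s, y s = 0 := ⟨s₀, blockVec_eq_zero hs₀⟩
    constructor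
    -- With `σ = ∑ y = 2 f(y)` the boundary bound reads `σ² ≤ 2σ`.
    · have := hv.le_four y hy0 hy₀
      rw [hysum] at this
      nlinarith
    -- If the gradient of `y` were at least 1 everywhere, pairing with `v` would give `∑ v ≤ σ`,
    -- while strict minimality says `σ² < (∑ v) σ`.
    · by_contra! hall
      have h1 := hv.lt_form y hy0 hy₀ (by rwa [hysum])
      have h2 : ∑ s, v s ≤ ∑ i, w i * #(F i) := by
        rw [← hvy]
        refine sum_le_sum fun s _ => ?_
        by_cases h : ∃ i, s ∈ F i
        · obtain ⟨i, hi⟩ := h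
          rw [hyrow i s hi, mul_one]
        · push Not at h
          rw [hy, row_blockVec, blockVec_eq_zero h, zero_add]
          exact le_mul_of_one_le_right (hv.pos s).le (hall s h)
      rw [hysum] at h1
      nlinarith

end Block

end Extremal

/-! ### Recognizing the posets from their comparability graphs, and forbidden induced subgraphs -/

section Structure

set_option linter.unusedSectionVars false

variable {S : Type*} [Fintype S] [PartialOrder S]

/-- The elements of `A` are pairwise comparable. -/
def Clique (A : Finset S) : Prop := ∀ a ∈ A, ∀ b ∈ A, Compar a b

/-- No element of `A` is comparable with an element of `B`. -/
def Separate (A B : Finset S) : Prop := ∀ a ∈ A, Apart a B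

lemma Separate.symm {A B : Finset S} (h : Separate A B) : Separate B A :=
  fun b hb a ha hab => h a ha b hb hab.symm

lemma Separate.disjoint {A B : Finset S} (h : Separate A B) : Disjoint A B :=
  disjoint_left.2 fun a ha hb => h a ha a hb (Compar.refl a)

lemma Separate.mono {A B A' B' : Finset S} (h : Separate A B) (hA : A' ⊆ A) (hB : B' ⊆ B) :
    Separate A' B' := fun a ha b hb => h a (hA ha) b (hB hb)

lemma Clique.mono {A A' : Finset S} (h : Clique A) (hA : A' ⊆ A) : Clique A' :=
  fun a ha b hb => h a (hA ha) b (hA hb)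

lemma clique_singleton (a : S) : Clique {a} := by
  simp [Clique, Compar.refl]

lemma comparCount_of_clique {A : Finset S} (h : Clique A) {s : S} (hs : s ∈ A) :
    comparCount A s = #A := comparCount_eq_card_iff.2 fun a ha => h s hs a ha

lemma comparCount_of_separate {A B : Finset S} (h : Separate A B) {s : S} (hs : s ∈ A) :
    comparCount B s = 0 := comparCount_eq_zero_iff.2 (h s hs)

lemma Clique.exists_orderIso {A : Finset S} (h : Clique A) {n : ℕ} (hn : #A = n) :
    Nonempty (Fin n ≃o A) := by
  classical
  let _ : LinearOrder A :=
    { (inferInstance : PartialOrder A) with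
      le_total := fun a b => h a a.2 b b.2
      toDecidableLE := Classical.decRel _ }
  exact ⟨Fintype.orderIsoFinOfCardEq A (by simpa using hn)⟩

/-- A partition into chains that are pairwise incomparable presents `S` as a union of chains. -/
lemma exists_orderIso_chainUnion {p : ℕ} {n : Fin p → ℕ} (F : Fin p → Finset S)
    (hcl : ∀ i, Clique (F i)) (hsep : ∀ i j, i ≠ j → Separate (F i) (F j))
    (hcard : ∀ i, #(F i) = n i) (hcov : ∀ s, ∃ i, s ∈ F i) :
    Nonempty (S ≃o ChainUnion n) := by
  have e := fun i => Classical.choice ((hcl i).exists_orderIso (hcard i))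
  let φ : ChainUnion n → S := fun x => e x.1 x.2
  have hφ : ∀ x y, φ x ≤ φ y ↔ x ≤ y := by
    rintro ⟨i, a⟩ ⟨j, b⟩
    by_cases hij : i = j
    · subst hij
      rw [Sigma.mk_le_mk_iff, ← (e i).le_iff_le]
      rfl
    · refine iff_of_false (fun h => ?_) fun h => ?_
      · exact hsep i j hij _ (e i a).2 _ (e j b).2 (Or.inl h)
      · obtain ⟨h, -⟩ := Sigma.le_def.1 h
        exact hij h
  have hsurj : Function.Surjective φ := by
    intro s
    obtain ⟨i, hi⟩ := hcov s
    exact ⟨⟨i, (e i).symm ⟨s, hi⟩⟩, by simp [φ]⟩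
  exact ⟨(RelIso.ofSurjective (OrderEmbedding.ofMapLEIff φ hφ) hsurj).symm⟩

/-- A path `b - a - d - c` in the comparability graph together with a separate chain. -/
structure KConfig (a b c d : S) (C : Finset S) : Prop where
  hab : Compar a b
  hcd : Compar c d
  had : Compar a d
  hac : ¬ Compar a c
  hbc : ¬ Compar b c
  hbd : ¬ Compar b d
  clique : Clique C
  ha : Apart a C
  hb : Apart b C
  hc : Apart c C
  hd : Apart d C

lemma KConfig.symm {a b c d : S} {C : Finset S} (h : KConfig a b c d C) : KConfig d c b a C where
  hab := h.hcd.symm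
  hcd := h.hab.symm
  had := h.had.symm
  hac := fun h' => h.hbd h'.symm
  hbc := fun h' => h.hbc h'.symm
  hbd := fun h' => h.hac h'.symm
  clique := h.clique
  ha := h.hd
  hb := h.hc
  hc := h.hb
  hd := h.ha

/-- Orienting the middle edge of an induced four-point path orients the outer two, since any other
choice would create a forbidden comparability by transitivity. -/
lemma KConfig.orderIso_of_le {a b c d : S} {C : Finset S} (h : KConfig a b c d C) (hle : a ≤ d)
    {m : ℕ} (hm : #C = m) (hcov : ∀ s, s = a ∨ s = b ∨ s = c ∨ s = d ∨ s ∈ C) :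
    Nonempty (S ≃o KWithChain m) := by
  obtain ⟨e⟩ := h.clique.exists_orderIso hm
  have hab : a ≤ b := h.hab.resolve_right fun h' => h.hbd (Or.inl (h'.trans hle))
  have hcd : c ≤ d := h.hcd.resolve_right fun h' => h.hac (Or.inl (hle.trans h'))
  have hac := not_or.1 h.hac
  have hbc := not_or.1 h.hbc
  have hbd := not_or.1 h.hbd
  have nba : ¬ b ≤ a := fun h' => hbd.1 (h'.trans hle)
  have nda : ¬ d ≤ a := fun h' => hbd.2 (h'.trans hab)
  have ndc : ¬ d ≤ c := fun h' => hac.1 (hle.trans h')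
  let f : Fin 4 → S := ![a, b, c, d]
  have hf : ∀ x y : Fin 4, f x ≤ f y ↔ KPoset.rel x y := by
    intro x y
    fin_cases x <;> fin_cases y <;> simp [f, KPoset.rel, *]
  have hfC : ∀ (x : Fin 4) (t : S), t ∈ C → ¬ Compar (f x) t := by
    intro x t ht
    fin_cases x
    · exact h.ha t ht
    · exact h.hb t ht
    · exact h.hc t ht
    · exact h.hd t ht
  let φ : KWithChain m → S := Sum.elim f (fun i => e i)
  have hφ : ∀ x y, φ x ≤ φ y ↔ x ≤ y := by
    rintro (x | x) (y | y)
    · rw [Sum.inl_le_inl_iff]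
      exact hf x y
    · exact iff_of_false (fun h' => hfC x _ (e y).2 (Or.inl h')) Sum.not_inl_le_inr
    · exact iff_of_false (fun h' => hfC y _ (e x).2 (Or.inr h')) Sum.not_inr_le_inl
    · rw [Sum.inr_le_inr_iff, ← e.le_iff_le]
      rfl
  have hsurj : Function.Surjective φ := by
    intro s
    rcases hcov s with h | h | h | h | h
    · exact ⟨Sum.inl (0 : Fin 4), h.symm⟩
    · exact ⟨Sum.inl (1 : Fin 4), h.symm⟩
    · exact ⟨Sum.inl (2 : Fin 4), h.symm⟩
    · exact ⟨Sum.inl (3 : Fin 4), h.symm⟩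
    · exact ⟨Sum.inr (e.symm ⟨s, h⟩), congrArg Subtype.val (e.apply_symm_apply ⟨s, h⟩)⟩
  exact ⟨(RelIso.ofSurjective (OrderEmbedding.ofMapLEIff φ hφ) hsurj).symm⟩

/-- If the middle edge is oriented the other way, reading the path backwards restores the
orientation of `K`. -/
lemma KConfig.exists_orderIso {a b c d : S} {C : Finset S} (h : KConfig a b c d C)
    {m : ℕ} (hm : #C = m) (hcov : ∀ s, s = a ∨ s = b ∨ s = c ∨ s = d ∨ s ∈ C) :
    Nonempty (S ≃o KWithChain m) := by
  rcases h.had with hle | hle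
  · exact h.orderIso_of_le hle hm hcov
  · exact h.symm.orderIso_of_le hle hm fun s => by have := hcov s; tauto

/-- The middle of an induced three-point path lies above both ends or below both ends; hence
orientations alternate along paths without chords between points at distance two. -/
lemma next_of_path {a b c : S} (hbc : Compar b c) (hac : ¬ Compar a c) :
    (a ≤ b → c ≤ b) ∧ (b ≤ a → b ≤ c) :=
  ⟨fun h => hbc.resolve_left fun h' => hac (Or.inl (h.trans h')),
    fun h => hbc.resolve_right fun h' => hac (Or.inr (h'.trans h))⟩

/-- The comparability graph has no induced pentagon. -/
lemma not_pentagon {a b c d e : S} (hab : Compar a b) (hbc : Compar b c) (hcd : Compar c d)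
    (hde : Compar d e) (hea : Compar e a) (hac : ¬ Compar a c) (hbd : ¬ Compar b d)
    (hce : ¬ Compar c e) (hda : ¬ Compar d a) (heb : ¬ Compar e b) : False := by
  have h1 := next_of_path hbc hac
  have h2 := next_of_path hcd hbd
  have h3 := next_of_path hde hce
  have h4 := next_of_path hea hda
  have h5 := next_of_path hab heb
  -- The alternation is carried once around the odd cycle and contradicts the starting orientation.
  rcases hab with h | h
  · exact heb (Or.inl ((h4.2 (h3.1 (h2.2 (h1.1 h)))).trans h))
  · exact heb (Or.inr (h.trans (h4.1 (h3.2 (h2.1 (h1.2 h))))))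

/-- The comparability graph has no induced heptagon; this only uses the non-edges at distance
two. -/
lemma not_heptagon {a b c d e f g : S} (hab : Compar a b) (hbc : Compar b c) (hcd : Compar c d)
    (hde : Compar d e) (hef : Compar e f) (hfg : Compar f g) (hga : Compar g a)
    (hac : ¬ Compar a c) (hbd : ¬ Compar b d) (hce : ¬ Compar c e) (hdf : ¬ Compar d f)
    (heg : ¬ Compar e g) (hfa : ¬ Compar f a) (hgb : ¬ Compar g b) : False := by
  have h1 := next_of_path hbc hac
  have h2 := next_of_path hcd hbd
  have h3 := next_of_path hde hce
  have h4 := next_of_path hef hdf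
  have h5 := next_of_path hfg heg
  have h6 := next_of_path hga hfa
  rcases hab with h | h
  · exact hgb (Or.inl ((h6.2 (h5.1 (h4.2 (h3.1 (h2.2 (h1.1 h)))))).trans h))
  · exact hgb (Or.inr (h.trans (h6.1 (h5.2 (h4.1 (h3.2 (h2.1 (h1.2 h))))))))

/-- The comparability graph has no induced net (a triangle with a pendant edge at every vertex). -/
lemma not_net {a b c a' b' c' : S} (hab : Compar a b) (hbc : Compar b c) (hca : Compar c a)
    (haa : Compar a a') (hbb : Compar b b') (hcc : Compar c c')
    (hab' : ¬ Compar a b') (hba' : ¬ Compar b a') (hbc' : ¬ Compar b c') (hcb' : ¬ Compar c b')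
    (hca' : ¬ Compar c a') (hac' : ¬ Compar a c') : False := by
  -- Its pendant edge forces each vertex of the triangle to be above both others or below both
  -- others, but a chain of three has a middle element.
  have h1 := next_of_path haa hba'
  have h2 := next_of_path haa hca'
  have h3 := next_of_path hbb hab'
  have h4 := next_of_path hbb hcb'
  have h5 := next_of_path hcc hac'
  have h6 := next_of_path hcc hbc'
  unfold Compar at *
  have t := fun x y z : S => @le_trans S _ x y z
  rcases hab with h | h <;> rcases hbc with h' | h' <;> rcases hca with h'' | h'' <;> grind

end Structure

/-! ### The listed posets are utmost -/

section Bounds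

set_option linter.unusedSectionVars false

/-- Quantitative bounds for the form of `S`: the best constant is `p`, attained at a positive
vector, and on the boundary the constant improves to `q`. -/
structure FormBounds (S : Type*) [Fintype S] [PartialOrder S] (p q : ℝ) : Prop where
  attained : ∃ u : S → ℝ, (∀ s, 0 < u s) ∧ 0 < ∑ s, u s ∧ (∑ s, u s) ^ 2 = p * posetForm S u
  le : ∀ x : S → ℝ, (∀ s, 0 ≤ x s) → (∑ s, x s) ^ 2 ≤ p * posetForm S x
  le_boundary : ∀ x : S → ℝ, (∀ s, 0 ≤ x s) → (∃ s, x s = 0) →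
    (∑ s, x s) ^ 2 ≤ q * posetForm S x

variable {S : Type*} [Fintype S] [PartialOrder S]

open Classical in
lemma posetForm_orderIso {S' : Type*} [Fintype S'] [PartialOrder S'] (e : S ≃o S') (x : S' → ℝ) :
    posetForm S (fun s => x (e s)) = posetForm S' x := by
  unfold posetForm
  rw [← e.toEquiv.sum_comp]
  refine sum_congr rfl fun s _ => ?_
  rw [← e.toEquiv.sum_comp]
  refine sum_congr rfl fun t _ => ?_
  simp

lemma FormBounds.of_orderIso {S' : Type*} [Fintype S'] [PartialOrder S'] (e : S ≃o S') {p q : ℝ}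
    (h : FormBounds S' p q) : FormBounds S p q := by
  have hs : ∀ x : S' → ℝ, ∑ s, x (e s) = ∑ s, x s := fun x => e.toEquiv.sum_comp x
  have hx : ∀ x : S → ℝ, x = fun s => (fun t => x (e.symm t)) (e s) := fun x => by ext s; simp
  refine ⟨?_, fun x h0 => ?_, fun x h0 h1 => ?_⟩
  · obtain ⟨u, h0, h1, h2⟩ := h.attained
    refine ⟨fun s => u (e s), fun s => h0 _, ?_, ?_⟩
    · rwa [hs]
    · rwa [hs, posetForm_orderIso]
  · have := h.le (fun t => x (e.symm t)) fun s => h0 _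
    rwa [← posetForm_orderIso e, ← hs, ← hx x] at this
  · obtain ⟨s, hs'⟩ := h1
    have := h.le_boundary (fun t => x (e.symm t)) (fun s => h0 _) ⟨e s, by simpa using hs'⟩
    rwa [← posetForm_orderIso e, ← hs, ← hx x] at this

/-- Normalizing the extremal vector gives a minimizer of value `p⁻¹`, so `P(S) = p`. The bound `q ≤
4` controls proper subsets, and `q < p` makes the boundary values strictly larger. -/
lemma FormBounds.utmost {p q : ℝ} (h : FormBounds S p q) (hp : 4 ≤ p) (hq : q ≤ 4) (hqp : q < p) :
    Utmost S := by
  obtain ⟨u, hu, hsum, heq⟩ := h.attained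
  have hp0 : 0 < p := by linarith
  have hval : ∀ w ∈ stdSimplex ℝ S, p⁻¹ ≤ posetForm S w := by
    intro w hw
    have := h.le w hw.1
    rw [hw.2] at this
    rw [inv_le_iff_one_le_mul₀ hp0]; linarith
  set u' : S → ℝ := fun s => (∑ t, u t)⁻¹ * u s with hu'
  have hu'mem : u' ∈ stdSimplex ℝ S := normalize_mem_stdSimplex (fun s => (hu s).le) hsum
  have hform : posetForm S u' = p⁻¹ := by
    rw [hu', posetForm_smul, inv_pow, heq, mul_inv, mul_assoc, inv_mul_cancel₀, mul_one]
    rintro h0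
    rw [h0, mul_zero] at heq
    exact (pow_pos hsum 2).ne' heq
  refine ⟨⟨u', ⟨fun s => mul_pos (inv_pos.2 hsum) (hu s), hu'mem.2⟩, ?_, fun w hw => ⟨?_, ?_⟩⟩,
    ?_, ?_⟩
  · rw [hform]; positivity
  · rw [hform]; exact hval w hw
  · intro hw'
    have hz : ∃ s, w s = 0 := by
      by_contra! hne
      exact hw' ⟨fun s => lt_of_le_of_ne (hw.1 s) (hne s).symm, hw.2⟩
    have := h.le_boundary w hw.1 hz
    rw [hw.2] at this
    rw [hform, inv_lt_iff_one_lt_mul₀ hp0]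
    have hpos : 0 < posetForm S w := lt_of_lt_of_le (inv_pos.2 hp0) (hval w hw)
    nlinarith
  · have : posetNorm S = p⁻¹ := by
      refine IsLeast.csInf_eq ⟨⟨u', hu'mem, hform⟩, ?_⟩
      rintro _ ⟨w, hw, rfl⟩
      exact hval w hw
    rw [posetP, this, inv_inv]
    exact hp
  · rw [posetP_subset_le_iff (by norm_num)]
    intro x hx hz
    have := h.le_boundary x hx hz
    nlinarith [posetForm_nonneg hx]

lemma posetForm_fin (n : ℕ) (x : Fin n → ℝ) :
    2 * posetForm (Fin n) x = (∑ i, x i) ^ 2 + ∑ i, x i ^ 2 := by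
  rw [two_mul_posetForm, sq, sum_mul, ← sum_add_distrib]
  refine sum_congr rfl fun i _ => ?_
  have : ∀ t, Compar i t := fun t => le_total i t
  simp [row, this]
  ring

/-- For a chain `2 f(x) = (∑ x)² + ∑ x²`, so both constants come from Cauchy–Schwarz; on the
boundary only `n - 1` coordinates remain, giving the constant of a chain with `n - 1` elements. -/
lemma formBounds_fin (n : ℕ) (hn : 0 < n) :
    FormBounds (Fin n) (2 * n / (n + 1)) (2 * (n - 1) / n) := by
  have hn' : (0 : ℝ) < n := by exact_mod_cast hn
  refine ⟨⟨fun _ => 1, by simp, by simpa using hn', ?_⟩, fun x _ => ?_, ?_⟩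
  · have := posetForm_fin n (fun _ => 1)
    simp only [sum_const, card_univ, Fintype.card_fin, nsmul_eq_mul, mul_one, one_pow] at this ⊢
    field_simp
    linarith
  · have h1 := posetForm_fin n x
    have h2 := sq_sum_le_card_mul_sum_sq (s := univ) (f := x)
    rw [card_univ, Fintype.card_fin] at h2
    rw [div_mul_eq_mul_div, le_div_iff₀ (by positivity)]
    nlinarith
  · rintro x - ⟨i, hi⟩
    have h1 := posetForm_fin n x
    have h2 := sq_sum_le_card_mul_sum_sq (s := univ.erase i) (f := x)
    rw [card_erase_of_mem (mem_univ i), card_univ, Fintype.card_fin, Nat.cast_sub hn,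
      sum_erase _ hi, sum_erase (f := fun i => x i ^ 2) _ (by simp [hi])] at h2
    push_cast at h2
    have hn1 : (1 : ℝ) ≤ n := by exact_mod_cast hn
    rw [div_mul_eq_mul_div, le_div_iff₀ hn']
    nlinarith

/-- Bounds for a disjoint union of finitely many posets. -/
lemma formBounds_sigma {p : ℕ} {α : Fin p → Type} [∀ i, Fintype (α i)]
    [∀ i, PartialOrder (α i)] (P Q : Fin p → ℝ) (hp : 0 < p) (hP : ∀ i, 0 < P i) (hQ : ∀ i, 0 ≤ Q i)
    (h : ∀ i, FormBounds (α i) (P i) (Q i)) {q : ℝ} (hq : ∀ i, ∑ j, P j - P i + Q i ≤ q) :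
    FormBounds (Σ i, α i) (∑ i, P i) q := by
  classical
  have hsum : ∀ x : (Σ i, α i) → ℝ, ∑ s, x s = ∑ i, ∑ a, x ⟨i, a⟩ := fun x =>
    Fintype.sum_sigma x
  have hform : ∀ x : (Σ i, α i) → ℝ,
      posetForm (Σ i, α i) x = ∑ i, posetForm (α i) (fun a => x ⟨i, a⟩) := by
    intro x
    have e1 : posetForm (Σ i, α i) x = ∑ s, ∑ t, if s ≤ t then x s * x t else 0 := by
      unfold posetForm; congr!
    have e2 : ∀ i, posetForm (α i) (fun a => x ⟨i, a⟩) =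
        ∑ a, ∑ b, if a ≤ b then x ⟨i, a⟩ * x ⟨i, b⟩ else 0 := by
      intro i
      unfold posetForm; congr!
    rw [e1, Fintype.sum_sigma]
    refine sum_congr rfl fun i _ => ?_
    rw [e2]
    refine sum_congr rfl fun a _ => ?_
    rw [Fintype.sum_sigma, sum_eq_single i]
    · refine sum_congr rfl fun b _ => ?_
      simp only [Sigma.mk_le_mk_iff]
    · intro j _ hj
      refine sum_eq_zero fun b _ => if_neg fun hle => ?_
      obtain ⟨h', -⟩ := Sigma.le_def.1 hle
      exact hj h'.symm
    · simp
  refine ⟨?_, fun x hx => ?_, fun x hx hz => ?_⟩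
  · have : ∀ i, ∃ u : α i → ℝ, (∀ s, 0 < u s) ∧ ∑ s, u s = P i ∧ posetForm (α i) u = P i := by
      intro i
      obtain ⟨u, h0, h1, h2⟩ := (h i).attained
      -- This scaling makes both the sum and the form equal to `P i`, which is the equality case of
      -- Cauchy–Schwarz across the components.
      set c := P i / ∑ s, u s with hc
      have hcs : c * ∑ s, u s = P i := by rw [hc]; field_simp
      refine ⟨fun s => c * u s, fun s => mul_pos (div_pos (hP i) h1) (h0 s), ?_, ?_⟩
      · rw [← mul_sum, hcs]
      · rw [posetForm_smul]
        have : P i * (c ^ 2 * posetForm (α i) u) = P i * P i := by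
          rw [← mul_left_comm, ← h2, ← mul_pow, hcs, sq]
        exact mul_left_cancel₀ (hP i).ne' this
    choose u hu0 hu1 hu2 using this
    refine ⟨fun s => u s.1 s.2, fun s => hu0 _ _, ?_, ?_⟩
    · rw [hsum]
      simp only [hu1]
      exact sum_pos (fun i _ => hP i) ⟨⟨0, hp⟩, mem_univ _⟩
    · rw [hsum, hform]
      simp only [hu1, hu2, sq]
  · rw [hsum, hform]
    exact sum_sq_le_sum_mul_sum_of_sq_le_mul univ (fun i _ => (hP i).le)
      (fun i _ => posetForm_nonneg fun a => hx _) (fun i _ => (h i).le _ fun a => hx _)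
  · obtain ⟨⟨i, a⟩, hia⟩ := hz
    -- A zero coordinate in component `i` allows the improved constant `Q i` there; the other
    -- components keep `P j`.
    have h1 := sum_sq_le_sum_mul_sum_of_sq_le_mul univ
      (r := fun j => ∑ a, x ⟨j, a⟩) (f := Function.update P i (Q i))
      (g := fun j => posetForm (α j) (fun a => x ⟨j, a⟩))
      (fun j _ => by
        by_cases hj : j = i
        · subst hj; simpa using hQ j
        · simpa [hj] using (hP j).le)
      (fun j _ => posetForm_nonneg fun a => hx _)
      (fun j _ => by
        by_cases hj : j = i
        · subst hj
          simpa using (h j).le_boundary _ (fun a => hx _) ⟨a, hia⟩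
        · simpa [hj] using (h j).le _ fun a => hx _)
    rw [hsum, hform]
    refine h1.trans (mul_le_mul_of_nonneg_right ?_
      (sum_nonneg fun i _ => posetForm_nonneg fun a => hx _))
    have h2 : ∑ j, Function.update P i (Q i) j = ∑ j, P j - P i + Q i := by
      rw [sum_update_of_mem (mem_univ i), sum_eq_add_sum_sdiff_singleton_of_mem (mem_univ i) P]
      ring
    rw [h2]
    exact hq i

lemma formBounds_chainUnion {p : ℕ} (n : Fin p → ℕ) (hp : 0 < p) (hn : ∀ i, 0 < n i) {q : ℝ}
    (hq : ∀ i, ∑ j, (2 * n j / (n j + 1) : ℝ) - 2 * n i / (n i + 1) + 2 * (n i - 1) / n i ≤ q) :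
    FormBounds (ChainUnion n) (∑ j, (2 * n j / (n j + 1) : ℝ)) q := by
  have hn' : ∀ i, (1 : ℝ) ≤ n i := fun i => by exact_mod_cast hn i
  refine formBounds_sigma (fun j => (2 * n j / (n j + 1) : ℝ)) (fun i => 2 * (n i - 1) / n i) hp
    (fun i => ?_) (fun i => ?_) (fun i => formBounds_fin (n i) (hn i)) hq
  · have := hn' i
    positivity
  · exact div_nonneg (mul_nonneg zero_le_two (sub_nonneg.2 (hn' i))) (by linarith [hn' i])

/-- The extremal vector is `(1, 2, 2, 1)`, with weight 2 at the ends of the path. The boundary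
constant `7/3 = 4/3 + 1` is that of a two-element chain plus a point, left after deleting an inner
point of the path. -/
lemma formBounds_kPoset : FormBounds KPoset (12 / 5) (7 / 3) := by
  have hsum : ∀ x : KPoset → ℝ, ∑ s, x s =
      x (0 : Fin 4) + x (1 : Fin 4) + x (2 : Fin 4) + x (3 : Fin 4) :=
    fun x => Fin.sum_univ_four x
  have hform : ∀ x : KPoset → ℝ, posetForm KPoset x =
      x (0 : Fin 4) ^ 2 + x (1 : Fin 4) ^ 2 + x (2 : Fin 4) ^ 2 + x (3 : Fin 4) ^ 2 +
      x (0 : Fin 4) * x (1 : Fin 4) + x (2 : Fin 4) * x (3 : Fin 4) +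
      x (0 : Fin 4) * x (3 : Fin 4) := by
    intro x
    have hx : ∀ y : Fin 4 → ℝ, ∑ s : Fin 4, ∑ t : Fin 4,
        @ite ℝ (KPoset.rel s t) (Classical.propDecidable _) (y s * y t) 0 =
        y 0 ^ 2 + y 1 ^ 2 + y 2 ^ 2 + y 3 ^ 2 + y 0 * y 1 + y 2 * y 3 + y 0 * y 3 := by
      intro y
      simp [Fin.sum_univ_four, KPoset.rel]
      ring
    exact hx x
  let u : KPoset → ℝ := fun s => (![1, 2, 2, 1] : Fin 4 → ℝ) s
  have u0 : u (0 : Fin 4) = 1 := rfl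
  have u1 : u (1 : Fin 4) = 2 := rfl
  have u2 : u (2 : Fin 4) = 2 := rfl
  have u3 : u (3 : Fin 4) = 1 := rfl
  refine ⟨⟨u, ?_, ?_, ?_⟩, fun x _ => ?_, ?_⟩
  · intro s
    have : ∀ i : Fin 4, (0 : ℝ) < ![1, 2, 2, 1] i := by
      intro i; fin_cases i <;> norm_num
    exact this s
  · rw [hsum, u0, u1, u2, u3]; norm_num
  · rw [hsum, hform, u0, u1, u2, u3]; norm_num
  · rw [hsum, hform]
    generalize x (0 : Fin 4) = a, x (1 : Fin 4) = b, x (2 : Fin 4) = c, x (3 : Fin 4) = d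
    nlinarith [sq_nonneg (2 * (a + d) - (b + c)), sq_nonneg ((a - d) + (b - c)), sq_nonneg (b - c)]
  · rintro x hx ⟨s, hs⟩
    rw [hsum, hform]
    have hs' : x (0 : Fin 4) = 0 ∨ x (1 : Fin 4) = 0 ∨ x (2 : Fin 4) = 0 ∨ x (3 : Fin 4) = 0 := by
      revert hs
      change Fin 4 at s
      fin_cases s <;> simp_all
    revert hs'
    generalize x (0 : Fin 4) = a, x (1 : Fin 4) = b, x (2 : Fin 4) = c, x (3 : Fin 4) = d
    rintro (rfl | rfl | rfl | rfl)
    · nlinarith [sq_nonneg (2 * b - 3 * c), sq_nonneg (2 * b - 3 * d), sq_nonneg (c - d)]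
    · nlinarith [sq_nonneg (a - c), sq_nonneg (a - d), sq_nonneg (c - d), sq_nonneg d,
        sq_nonneg (a + d - c), sq_nonneg a]
    · nlinarith [sq_nonneg (d - b), sq_nonneg (d - a), sq_nonneg (b - a), sq_nonneg a,
        sq_nonneg (d + a - b), sq_nonneg d]
    · nlinarith [sq_nonneg (2 * c - 3 * b), sq_nonneg (2 * c - 3 * a), sq_nonneg (b - a)]

/-- Bounds for a disjoint union of two posets. -/
lemma formBounds_sum {α β : Type*} [Fintype α] [Fintype β] [PartialOrder α] [PartialOrder β]
    {p₁ q₁ p₂ q₂ q : ℝ} (h₁ : FormBounds α p₁ q₁) (h₂ : FormBounds β p₂ q₂) (hp₁ : 0 < p₁)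
    (hp₂ : 0 < p₂) (hq₁ : 0 ≤ q₁) (hq₂ : 0 ≤ q₂) (h₁₂ : q₁ + p₂ ≤ q) (h₂₁ : p₁ + q₂ ≤ q) :
    FormBounds (α ⊕ β) (p₁ + p₂) q := by
  classical
  have hform : ∀ x : α ⊕ β → ℝ, posetForm (α ⊕ β) x =
      posetForm α (fun a => x (Sum.inl a)) + posetForm β (fun b => x (Sum.inr b)) := by
    intro x
    unfold posetForm
    simp [Fintype.sum_sum_type, Sum.inl_le_inl_iff, Sum.inr_le_inr_iff]
  have key : ∀ {X Y f g P Q : ℝ}, 0 ≤ P → 0 ≤ Q → 0 ≤ f → 0 ≤ g → X ^ 2 ≤ P * f → Y ^ 2 ≤ Q * g →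
      (X + Y) ^ 2 ≤ (P + Q) * (f + g) := by
    intro X Y f g P Q hP hQ hf hg hX hY
    have := sum_sq_le_sum_mul_sum_of_sq_le_mul (univ : Finset (Fin 2)) (r := ![X, Y])
      (f := ![P, Q]) (g := ![f, g]) (by simp [Fin.forall_fin_two, hP, hQ])
      (by simp [Fin.forall_fin_two, hf, hg]) (by simp [Fin.forall_fin_two, hX, hY])
    simpa using this
  refine ⟨?_, fun x hx => ?_, fun x hx hz => ?_⟩
  · obtain ⟨u, hu0, hu1, hu2⟩ := h₁.attained
    obtain ⟨w, hw0, hw1, hw2⟩ := h₂.attained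
    set s := ∑ a, u a
    set t := ∑ b, w b
    refine ⟨Sum.elim (fun a => p₁ / s * u a) (fun b => p₂ / t * w b), ?_, ?_, ?_⟩
    · rintro (a | b)
      · exact mul_pos (div_pos hp₁ hu1) (hu0 a)
      · exact mul_pos (div_pos hp₂ hw1) (hw0 b)
    all_goals
      rw [Fintype.sum_sum_type]
      simp only [Sum.elim_inl, Sum.elim_inr, ← mul_sum]
    · have : 0 < p₁ / s * s + p₂ / t * t := by positivity
      exact this
    · rw [hform]
      simp only [Sum.elim_inl, Sum.elim_inr, posetForm_smul]
      change (p₁ / s * s + p₂ / t * t) ^ 2 = _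
      have e1 : (p₁ / s) ^ 2 * posetForm α u = p₁ := by
        field_simp
        linarith
      have e2 : (p₂ / t) ^ 2 * posetForm β w = p₂ := by
        field_simp
        linarith
      rw [e1, e2, div_mul_cancel₀ _ hu1.ne', div_mul_cancel₀ _ hw1.ne', sq]
  all_goals
    have f0 : 0 ≤ posetForm α (fun a => x (Sum.inl a)) := posetForm_nonneg fun a => hx _
    have g0 : 0 ≤ posetForm β (fun b => x (Sum.inr b)) := posetForm_nonneg fun b => hx _
    have hX := h₁.le (fun a => x (Sum.inl a)) fun a => hx _
    have hY := h₂.le (fun b => x (Sum.inr b)) fun b => hx _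
    rw [Fintype.sum_sum_type, hform]
  · exact key hp₁.le hp₂.le f0 g0 hX hY
  · obtain ⟨a | b, hs⟩ := hz
    · exact (key hq₁ hp₂.le f0 g0 (h₁.le_boundary _ (fun a => hx _) ⟨a, hs⟩) hY).trans
        (mul_le_mul_of_nonneg_right h₁₂ (add_nonneg f0 g0))
    · exact (key hp₁.le hq₂ f0 g0 hX (h₂.le_boundary _ (fun b => hx _) ⟨b, hs⟩)).trans
        (mul_le_mul_of_nonneg_right h₂₁ (add_nonneg f0 g0))

lemma utmost_kWithChain_four (e : S ≃o KWithChain 4) : Utmost S := by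
  refine (FormBounds.of_orderIso e (formBounds_sum (q := 59 / 15) formBounds_kPoset
    (formBounds_fin 4 (by norm_num)) ?_ ?_ ?_ ?_ ?_ ?_)).utmost ?_ ?_ ?_ <;> norm_num

lemma utmost_kWithChain_five (e : S ≃o KWithChain 5) : Utmost S := by
  refine (FormBounds.of_orderIso e (formBounds_sum (q := 4) formBounds_kPoset
    (formBounds_fin 5 (by norm_num)) ?_ ?_ ?_ ?_ ?_ ?_)).utmost ?_ ?_ ?_ <;> norm_num

lemma utmost_chainUnion {p : ℕ} {n : Fin p → ℕ} (q : ℝ) (e : S ≃o ChainUnion n) (hp : 0 < p)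
    (hn : ∀ i, 0 < n i)
    (hq : ∀ i, ∑ j, (2 * n j / (n j + 1) : ℝ) - 2 * n i / (n i + 1) + 2 * (n i - 1) / n i ≤ q)
    (h4 : 4 ≤ ∑ j, (2 * n j / (n j + 1) : ℝ)) (hq4 : q ≤ 4)
    (hqp : q < ∑ j, (2 * n j / (n j + 1) : ℝ)) : Utmost S :=
  (FormBounds.of_orderIso e (formBounds_chainUnion n hp hn hq)).utmost h4 hq4 hqp

/-- The posets of both lists are utmost. -/
theorem utmost_of_inList (h : InListI S ∨ InListII S) : Utmost S := by
  rcases h with (⟨⟨e⟩⟩ | ⟨⟨e⟩⟩ | ⟨⟨e⟩⟩ | ⟨⟨e⟩⟩ | ⟨⟨e⟩⟩) |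
    (⟨⟨e⟩⟩ | ⟨⟨e⟩⟩ | ⟨⟨e⟩⟩ | ⟨⟨e⟩⟩ | ⟨⟨e⟩⟩ | ⟨⟨e⟩⟩)
  -- In each case the supplied `q` is the largest constant after one point is deleted. It is below 4
  -- for list I, where `P = 4`, and equal to 4 for list II, where `P > 4`.
  · refine utmost_chainUnion 3 e ?_ ?_ ?_ ?_ ?_ ?_ <;>
      norm_num [Fin.sum_univ_succ, Fin.forall_fin_succ]
  · refine utmost_chainUnion (11 / 3) e ?_ ?_ ?_ ?_ ?_ ?_ <;>
      norm_num [Fin.sum_univ_succ, Fin.forall_fin_succ]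
  · refine utmost_chainUnion (23 / 6) e ?_ ?_ ?_ ?_ ?_ ?_ <;>
      norm_num [Fin.sum_univ_succ, Fin.forall_fin_succ]
  · refine utmost_chainUnion (59 / 15) e ?_ ?_ ?_ ?_ ?_ ?_ <;>
      norm_num [Fin.sum_univ_succ, Fin.forall_fin_succ]
  · exact utmost_kWithChain_four e
  · refine utmost_chainUnion 4 e ?_ ?_ ?_ ?_ ?_ ?_ <;>
      norm_num [Fin.sum_univ_succ, Fin.forall_fin_succ]
  · refine utmost_chainUnion 4 e ?_ ?_ ?_ ?_ ?_ ?_ <;>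
      norm_num [Fin.sum_univ_succ, Fin.forall_fin_succ]
  · refine utmost_chainUnion 4 e ?_ ?_ ?_ ?_ ?_ ?_ <;>
      norm_num [Fin.sum_univ_succ, Fin.forall_fin_succ]
  · refine utmost_chainUnion 4 e ?_ ?_ ?_ ?_ ?_ ?_ <;>
      norm_num [Fin.sum_univ_succ, Fin.forall_fin_succ]
  · refine utmost_chainUnion 4 e ?_ ?_ ?_ ?_ ?_ ?_ <;>
      norm_num [Fin.sum_univ_succ, Fin.forall_fin_succ]
  · exact utmost_kWithChain_five e

end Bounds

/-! ### Antichains of size three, four and five -/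

section Width

set_option linter.unusedSectionVars false

variable {S : Type*} [Fintype S] [PartialOrder S]

/-- The alternative `UtmostData.cover_or_grow` for pairwise separate nonempty cliques. -/
lemma UtmostData.cliques_cover_or_grow {v : S → ℝ} (hv : UtmostData v) {p : ℕ}
    (F : Fin p → Finset S) (hp : 0 < p) (hcl : ∀ i, Clique (F i))
    (hsep : ∀ i j, i ≠ j → Separate (F i) (F j)) (hne : ∀ i, (F i).Nonempty) :
    ((∀ s, ∃ i, s ∈ F i) ∧ 2 ≤ ∑ i, (#(F i) / (#(F i) + 1) : ℝ)) ∨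
      (∑ i, (#(F i) / (#(F i) + 1) : ℝ) ≤ 2 ∧
        ∃ s, (∀ i, s ∉ F i) ∧ ∑ i, (comparCount (F i) s / (#(F i) + 1) : ℝ) < 1) := by
  have h := hv.cover_or_grow (fun i => ((#(F i) + 1 : ℝ))⁻¹) F (fun i => by positivity)
    (fun i j hij => (hsep i j hij).disjoint) ?_ ?_
  · simpa only [inv_mul_eq_div] using h
  · intro i t ht
    rw [sum_eq_single i]
    · rw [comparCount_of_clique (hcl i) ht]
      field_simp
      ring
    · intro j _ hji
      rw [comparCount_of_separate (hsep i j hji.symm) ht]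
      simp
    · simp
  · refine sum_pos (fun i _ => ?_) ⟨⟨0, hp⟩, mem_univ _⟩
    have : 0 < #(F i) := card_pos.2 (hne i)
    positivity

/-- In width at most two, incomparable `s`, `t` have every element among their neighbours, so adding
the gradient equations at `s` and `t` gives `∑ v < 2`. For a chain one equation gives `∑ v < 1`. -/
lemma UtmostData.exists_antichain_three {v : S → ℝ} (hv : UtmostData v) :
    ∃ a b c : S, ¬ Compar a b ∧ ¬ Compar a c ∧ ¬ Compar b c := by
  classical
  by_contra! hno
  have h2 := hv.two_le
  have hrow : ∀ s, v s + ∑ t, (if Compar s t then v t else 0) = 1 := fun s => by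
    have := hv.row_eq s
    unfold row at this
    convert this
  by_cases hc : ∀ s t : S, Compar s t
  · have hne : Nonempty S := by
      by_contra hne
      rw [not_nonempty_iff] at hne
      simp at h2
      linarith
    obtain ⟨s⟩ := hne
    have := hrow s
    simp only [hc, if_true] at this
    linarith [hv.pos s]
  · push Not at hc
    obtain ⟨s, t, hst⟩ := hc
    have h : ∑ r, v r ≤ (∑ r, if Compar s r then v r else 0) + ∑ r, if Compar t r then v r else 0 := by
      rw [← sum_add_distrib]
      refine sum_le_sum fun r _ => ?_
      have hr := hv.pos r
      by_cases h1 : Compar s r <;> by_cases h2 : Compar t r <;> simp [h1, h2]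
      · exact hr.le
      · exact absurd (hno s t r hst h1) h2
    linarith [hrow s, hrow t, hv.pos s, hv.pos t]

/-- An utmost poset with a five-element antichain. -/
lemma UtmostData.of_antichain_five {v : S → ℝ} (hv : UtmostData v) (x : Fin 5 → S)
    (hx : ∀ i j, i ≠ j → ¬ Compar (x i) (x j)) :
    Nonempty (S ≃o ChainUnion ![1, 1, 1, 1, 1]) := by
  have hsep : ∀ i j, i ≠ j → Separate ({x i} : Finset S) {x j} := by
    intro i j hij
    simpa [Separate, Apart] using hx i j hij
  rcases hv.cliques_cover_or_grow (fun i => {x i}) (by norm_num) (fun i => clique_singleton _) hsep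
    (fun i => singleton_nonempty _) with ⟨hcov, -⟩ | ⟨hle, -⟩
  · refine exists_orderIso_chainUnion _ (fun i => clique_singleton _) hsep (fun i => ?_) hcov
    fin_cases i <;> rfl
  -- The total weight `5/2` exceeds 2, so the antichain must fill `S`.
  · norm_num at hle

/-- An utmost poset with a four-element antichain and no larger antichain. -/
lemma UtmostData.of_antichain_four {v : S → ℝ} (hv : UtmostData v) (x : Fin 4 → S)
    (hx : ∀ i j, i ≠ j → ¬ Compar (x i) (x j))
    (h5 : ∀ y : Fin 5 → S, ¬ ∀ i j, i ≠ j → ¬ Compar (y i) (y j)) :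
    Nonempty (S ≃o ChainUnion ![1, 1, 1, 1]) ∨ Nonempty (S ≃o ChainUnion ![1, 1, 1, 2]) := by
  classical
  have hsep : ∀ i j, i ≠ j → Separate ({x i} : Finset S) {x j} := by
    intro i j hij
    simpa [Separate, Apart] using hx i j hij
  rcases hv.cliques_cover_or_grow (fun i => {x i}) (by norm_num) (fun i => clique_singleton _) hsep
    (fun i => singleton_nonempty _) with ⟨hcov, -⟩ | ⟨-, s, hs, hlt⟩
  · refine Or.inl (exists_orderIso_chainUnion _ (fun i => clique_singleton _) hsep (fun i => ?_)
      hcov)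
    fin_cases i <;> rfl
  right
  obtain ⟨k, hk⟩ : ∃ k, Compar s (x k) := by
    by_contra! hno
    refine h5 (Fin.cons s x) fun i j hij => ?_
    refine Fin.cases (fun hij => ?_) (fun i hij => ?_) i hij <;>
    refine Fin.cases (fun hij => ?_) (fun j hij => ?_) j hij
    · exact absurd rfl hij
    · simpa using hno j
    · simpa using fun h : Compar (x i) s => hno i h.symm
    · simpa using hx i j fun h => hij (by rw [h])
  -- Two neighbours of weight 1/2 would already bring the gradient at `s` up to 1.
  have huniq : ∀ j, j ≠ k → ¬ Compar s (x j) := by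
    intro j hjk hj
    have : ∑ i ∈ {j, k}, (comparCount {x i} s / (#{x i} + 1) : ℝ) ≤
        ∑ i, (comparCount {x i} s / (#{x i} + 1) : ℝ) :=
      sum_le_sum_of_subset_of_nonneg (subset_univ _) fun i _ _ => by positivity
    rw [sum_pair hjk] at this
    simp only [comparCount_singleton, hj, hk, if_true, card_singleton] at this
    norm_num at this
    simp only [comparCount_singleton, card_singleton] at hlt
    norm_num at hlt
    linarith
  -- The swap moves the two-element chain to the last position, as in `![1, 1, 1, 2]`.
  set σ : Equiv.Perm (Fin 4) := Equiv.swap k 3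
  set F : Fin 4 → Finset S := fun i => if σ i = k then {x k, s} else {x (σ i)} with hF
  have hFcl : ∀ i, Clique (F i) := by
    intro i
    simp only [hF]
    split_ifs
    · intro a ha b hb
      simp only [mem_insert, mem_singleton] at ha hb
      rcases ha with rfl | rfl <;> rcases hb with rfl | rfl
      exacts [Compar.refl _, hk.symm, hk, Compar.refl _]
    · exact clique_singleton _
  have hFsep : ∀ i j, i ≠ j → Separate (F i) (F j) := by
    have key : ∀ i, i ≠ k → Separate ({x k, s} : Finset S) {x i} := by
      intro i hi a ha b hb
      simp only [mem_insert, mem_singleton] at ha hb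
      rcases ha with rfl | rfl <;> subst hb
      exacts [hx _ _ hi.symm, huniq _ hi]
    intro i j hij
    have hij' : σ i ≠ σ j := σ.injective.ne hij
    simp only [hF]
    split_ifs with h1 h2 h2
    · exact absurd (h1.trans h2.symm) hij'
    · exact key _ h2
    · exact (key _ h1).symm
    · exact hsep _ _ hij'
  have hcard : ∀ i, #(F i) = ![1, 1, 1, 2] i := by
    intro i
    have hne : x k ≠ s := fun h => hs k (by simp [h])
    have h3 : σ i = k ↔ i = 3 := by
      rw [← Equiv.swap_apply_right k 3]
      exact σ.injective.eq_iff
    simp only [hF, h3]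
    fin_cases i <;> simp [card_pair hne]
  refine exists_orderIso_chainUnion F hFcl hFsep hcard ?_
  rcases hv.cliques_cover_or_grow F (by norm_num) hFcl hFsep
    (fun i => by
      rw [← card_pos, hcard]
      fin_cases i <;> simp) with ⟨hcov, -⟩ | ⟨hle, -⟩
  · exact hcov
  -- The total is now `3/2 + 2/3 = 13/6 > 2`, so nothing further can be outside.
  · simp only [hcard] at hle
    norm_num [Fin.sum_univ_succ] at hle

end Width

/-! ### Triples of chains, and exclusion of the six-point path -/

section Triples

set_option linter.unusedSectionVars false

variable {S : Type*} [Fintype S] [PartialOrder S]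

/-- Three nonempty chains with elements of different chains incomparable. -/
structure Triple (A B C : Finset S) : Prop where
  cliqueA : Clique A
  cliqueB : Clique B
  cliqueC : Clique C
  sepAB : Separate A B
  sepAC : Separate A C
  sepBC : Separate B C
  neA : A.Nonempty
  neB : B.Nonempty
  neC : C.Nonempty

/-- The quantity `3 - P / 2` of a union of three chains. -/
noncomputable def tripleCost (A B C : Finset S) : ℝ :=
  1 / (#A + 1) + 1 / (#B + 1) + 1 / (#C + 1)

/-- Every union of three chains in `S` has cost at least `c`. -/
def MinCost (S : Type*) [Fintype S] [PartialOrder S] (c : ℝ) : Prop :=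
  ∀ A B C : Finset S, Triple A B C → c ≤ tripleCost A B C

/-- There is no four-element antichain. -/
def NoFour (S : Type*) [PartialOrder S] : Prop :=
  ∀ a b c d : S, ¬ Compar a b → ¬ Compar a c → ¬ Compar a d → ¬ Compar b c → ¬ Compar b d →
    Compar c d

lemma Triple.rotate {A B C : Finset S} (h : Triple A B C) : Triple B C A :=
  ⟨h.cliqueB, h.cliqueC, h.cliqueA, h.sepBC, h.sepAB.symm, h.sepAC.symm, h.neB, h.neC, h.neA⟩

lemma Triple.swap {A B C : Finset S} (h : Triple A B C) : Triple A C B :=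
  ⟨h.cliqueA, h.cliqueC, h.cliqueB, h.sepAC, h.sepAB, h.sepBC.symm, h.neA, h.neC, h.neB⟩

lemma clique_pair [DecidableEq S] {a b : S} (h : Compar a b) : Clique ({a, b} : Finset S) := by
  grind [Clique, Compar.symm, Compar.refl]

lemma clique_three [DecidableEq S] {a b c : S} (hab : Compar a b) (hac : Compar a c)
    (hbc : Compar b c) : Clique ({a, b, c} : Finset S) := by
  grind [Clique, Compar.symm, Compar.refl]

lemma card_three [DecidableEq S] {a b c : S} (hab : a ≠ b) (hac : a ≠ c) (hbc : b ≠ c) :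
    #({a, b, c} : Finset S) = 3 := card_eq_three.2 ⟨a, b, c, hab, hac, hbc, rfl⟩

/-- Three chains of sizes 3, 1, 1 cost `1/4 + 1/2 + 1/2 = 5/4`. The other `not_triple` lemmas
likewise forbid a triple cheaper than the assumed minimum. -/
lemma MinCost.not_triple_311 {c : ℝ} (hmin : MinCost S c) (hc : 5 / 4 < c) {p q r t u : S}
    (hpq : p ≠ q) (hpr : p ≠ r) (hqr : q ≠ r) (cpq : Compar p q) (cpr : Compar p r)
    (cqr : Compar q r) (npt : ¬ Compar p t) (nqt : ¬ Compar q t) (nrt : ¬ Compar r t)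
    (npu : ¬ Compar p u) (nqu : ¬ Compar q u) (nru : ¬ Compar r u) (ntu : ¬ Compar t u) : False := by
  classical
  have h := hmin {p, q, r} {t} {u} ⟨clique_three cpq cpr cqr, clique_singleton _,
    clique_singleton _, by grind [Separate, Apart], by grind [Separate, Apart],
    by grind [Separate, Apart], by simp, by simp, by simp⟩
  rw [tripleCost, card_three hpq hpr hqr] at h
  norm_num at h
  linarith

lemma MinCost.not_triple_221 {c : ℝ} (hmin : MinCost S c) (hc : 7 / 6 < c) {p q r t u : S}
    (hpq : p ≠ q) (hrt : r ≠ t) (cpq : Compar p q) (crt : Compar r t)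
    (npr : ¬ Compar p r) (npt : ¬ Compar p t) (nqr : ¬ Compar q r) (nqt : ¬ Compar q t)
    (npu : ¬ Compar p u) (nqu : ¬ Compar q u) (nru : ¬ Compar r u) (ntu : ¬ Compar t u) : False := by
  classical
  have h := hmin {p, q} {r, t} {u} ⟨clique_pair cpq, clique_pair crt,
    clique_singleton _, by grind [Separate, Apart], by grind [Separate, Apart],
    by grind [Separate, Apart], by simp, by simp, by simp⟩
  rw [tripleCost, card_pair hpq, card_pair hrt] at h
  norm_num at h
  linarith

lemma MinCost.not_triple_321 {c : ℝ} (hmin : MinCost S c) (hc : 13 / 12 < c) {p q r t u w : S}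
    (hpq : p ≠ q) (hpr : p ≠ r) (hqr : q ≠ r) (htu : t ≠ u) (cpq : Compar p q) (cpr : Compar p r)
    (cqr : Compar q r) (ctu : Compar t u)
    (npt : ¬ Compar p t) (nqt : ¬ Compar q t) (nrt : ¬ Compar r t)
    (npu : ¬ Compar p u) (nqu : ¬ Compar q u) (nru : ¬ Compar r u)
    (npw : ¬ Compar p w) (nqw : ¬ Compar q w) (nrw : ¬ Compar r w)
    (ntw : ¬ Compar t w) (nuw : ¬ Compar u w) : False := by
  classical
  have h := hmin {p, q, r} {t, u} {w} ⟨clique_three cpq cpr cqr, clique_pair ctu,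
    clique_singleton _, by grind [Separate, Apart], by grind [Separate, Apart],
    by grind [Separate, Apart], by simp, by simp, by simp⟩
  rw [tripleCost, card_three hpq hpr hqr, card_pair htu] at h
  norm_num at h
  linarith

open Classical in
/-- The growth alternative for a configuration of points with weights `w i / D`, of total weight
less than two. -/
lemma UtmostData.points_grow {v : S → ℝ} (hv : UtmostData v) {m : ℕ} (x : Fin m → S)
    (w : Fin m → ℕ) (D : ℕ) (hinj : Function.Injective x)
    (hrow : ∀ i, w i + ∑ j, w j * (if Compar (x i) (x j) then 1 else 0) = D)
    (hpos : 0 < ∑ i, w i) (hlt : ∑ i, w i < 2 * D) :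
    ∃ s, (∀ i, s ≠ x i) ∧ ∑ i, w i * (if Compar s (x i) then 1 else 0) < D := by
  have hD : (0 : ℝ) < D := by exact_mod_cast (by omega : 0 < D)
  have hpos' : 0 < ∑ i, (w i : ℝ) := by exact_mod_cast hpos
  have hlt' : ∑ i, (w i : ℝ) < 2 * D := by exact_mod_cast hlt
  have hsum : ∀ s, ∑ i, (w i / D : ℝ) * (comparCount {x i} s : ℝ) =
      ((∑ i, w i * (if Compar s (x i) then 1 else 0) : ℕ) : ℝ) / D := by
    intro s
    push_cast
    rw [sum_div]
    refine sum_congr rfl fun i _ => ?_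
    rw [comparCount_singleton]
    split_ifs <;> simp
  have hrow' : ∀ i, ∀ t ∈ ({x i} : Finset S),
      (w i / D : ℝ) + ∑ j, (w j / D : ℝ) * (comparCount {x j} t : ℝ) = 1 := by
    intro i t ht
    rw [mem_singleton] at ht
    subst ht
    rw [hsum, ← add_div, div_eq_one_iff_eq hD.ne']
    exact_mod_cast hrow i
  rcases hv.cover_or_grow (fun i => (w i / D : ℝ)) (fun i => {x i}) (fun i => by positivity)
    (fun i j hij => disjoint_singleton.2 (hinj.ne hij)) hrow'
    (by simpa [← sum_div] using div_pos hpos' hD) with ⟨-, h⟩ | ⟨-, s, hs, h⟩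
  · simp only [card_singleton, Nat.cast_one, mul_one, ← sum_div] at h
    rw [le_div_iff₀ hD] at h
    linarith
  · refine ⟨s, fun i => by simpa using hs i, ?_⟩
    rw [hsum, div_lt_one hD] at h
    exact_mod_cast h

/-- Adjacency of the path with six vertices (including loops). -/
def pathAdj (i j : Fin 6) : Prop := (i : ℕ) ≤ j + 1 ∧ (j : ℕ) ≤ i + 1

instance : DecidableRel pathAdj := fun _ _ => inferInstanceAs (Decidable (_ ∧ _))

/-- The weights `(3, 1, 2, 2, 1, 3) / 7` have gradient 1 on the path and total `12/7 < 2`, so a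
further point `s` exists. Its adjacency to the path is restricted by the absence of four-element
antichains, by minimal cost and by odd cycles, and no adjacency pattern of gradient below 1
survives. -/
lemma UtmostData.not_path {v : S → ℝ} (hv : UtmostData v) (h4 : NoFour S)
    (hmin : MinCost S (4 / 3)) (x : Fin 6 → S)
    (hx : ∀ i j, Compar (x i) (x j) ↔ pathAdj i j) : False := by
  classical
  -- Distinct vertices of the path have distinct closed neighbourhoods.
  have hinj : Function.Injective x := by
    intro i j hij
    exact (by decide : ∀ i j, (∀ k, pathAdj i k ↔ pathAdj j k) → i = j) i j
      fun k => by rw [← hx, ← hx, hij]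
  obtain ⟨s, hs, hlt⟩ := hv.points_grow x ![3, 1, 2, 2, 1, 3] 7 hinj (by
      simp only [hx]
      intro i
      fin_cases i <;> norm_num [Fin.sum_univ_succ, pathAdj])
    (by decide) (by decide)
  have E1 : Compar s (x 0) ∨ Compar s (x 2) ∨ Compar s (x 4) := by
    by_contra! h
    exact absurd (h4 s (x 0) (x 2) (x 4) h.1 h.2.1 h.2.2 (by rw [hx]; decide) (by rw [hx]; decide))
      (by rw [hx]; decide)
  have E2 : Compar s (x 0) ∨ Compar s (x 2) ∨ Compar s (x 5) := by
    by_contra! h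
    exact absurd (h4 s (x 0) (x 2) (x 5) h.1 h.2.1 h.2.2 (by rw [hx]; decide) (by rw [hx]; decide))
      (by rw [hx]; decide)
  have E3 : Compar s (x 0) ∨ Compar s (x 3) ∨ Compar s (x 5) := by
    by_contra! h
    exact absurd (h4 s (x 0) (x 3) (x 5) h.1 h.2.1 h.2.2 (by rw [hx]; decide) (by rw [hx]; decide))
      (by rw [hx]; decide)
  have E4 : Compar s (x 1) ∨ Compar s (x 3) ∨ Compar s (x 5) := by
    by_contra! h
    exact absurd (h4 s (x 1) (x 3) (x 5) h.1 h.2.1 h.2.2 (by rw [hx]; decide) (by rw [hx]; decide))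
      (by rw [hx]; decide)
  have D1 : Compar s (x 2) → Compar s (x 3) → ¬ Compar s (x 0) → Compar s (x 5) := by
    intro _ _ _
    by_contra
    refine hmin.not_triple_311 (by norm_num) (p := s) (q := x 2) (r := x 3) (t := x 0) (u := x 5)
      (hs _) (hs _) (hinj.ne (by decide)) ?_ ?_ ?_ ?_ ?_ ?_ ?_ ?_ ?_ ?_ <;>
    first | assumption | (rw [hx]; decide)
  have D2 : Compar s (x 0) → Compar s (x 1) → ¬ Compar s (x 3) → Compar s (x 5) := by
    intro _ _ _
    by_contra
    refine hmin.not_triple_311 (by norm_num) (p := s) (q := x 0) (r := x 1) (t := x 3) (u := x 5)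
      (hs _) (hs _) (hinj.ne (by decide)) ?_ ?_ ?_ ?_ ?_ ?_ ?_ ?_ ?_ ?_ <;>
    first | assumption | (rw [hx]; decide)
  have D3 : Compar s (x 5) → Compar s (x 4) → ¬ Compar s (x 2) → Compar s (x 0) := by
    intro _ _ _
    by_contra
    refine hmin.not_triple_311 (by norm_num) (p := s) (q := x 5) (r := x 4) (t := x 2) (u := x 0)
      (hs _) (hs _) (hinj.ne (by decide)) ?_ ?_ ?_ ?_ ?_ ?_ ?_ ?_ ?_ ?_ <;>
    first | assumption | (rw [hx]; decide)
  have D4 : Compar s (x 0) → ¬ Compar s (x 2) → ¬ Compar s (x 4) → Compar s (x 5) := by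
    intro _ _ _
    by_contra
    refine hmin.not_triple_221 (by norm_num) (p := s) (q := x 0) (r := x 4) (t := x 5) (u := x 2)
      (hs _) (hinj.ne (by decide)) ?_ ?_ ?_ ?_ ?_ ?_ ?_ ?_ ?_ ?_ <;>
    first | assumption | (rw [hx]; decide)
  have D5 : Compar s (x 5) → ¬ Compar s (x 3) → ¬ Compar s (x 1) → Compar s (x 0) := by
    intro _ _ _
    by_contra
    refine hmin.not_triple_221 (by norm_num) (p := s) (q := x 5) (r := x 0) (t := x 1) (u := x 3)
      (hs _) (hinj.ne (by decide)) ?_ ?_ ?_ ?_ ?_ ?_ ?_ ?_ ?_ ?_ <;>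
    first | assumption | (rw [hx]; decide)
  have D6 : Compar s (x 0) → Compar s (x 3) → ¬ Compar s (x 1) → Compar s (x 2) := by
    intro h0 h3 h1
    by_contra h2
    exact not_pentagon h0 ((hx 0 1).2 (by decide)) ((hx 1 2).2 (by decide))
      ((hx 2 3).2 (by decide)) h3.symm h1 (by rw [hx]; decide) (by rw [hx]; decide)
      (fun h => h2 h.symm) (by rw [hx]; decide)
  have D7 : Compar s (x 5) → Compar s (x 2) → ¬ Compar s (x 4) → Compar s (x 3) := by
    intro h0 h3 h1
    by_contra h2
    exact not_pentagon h0 ((hx 5 4).2 (by decide)) ((hx 4 3).2 (by decide))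
      ((hx 3 2).2 (by decide)) h3.symm h1 (by rw [hx]; decide) (by rw [hx]; decide)
      (fun h => h2 h.symm) (by rw [hx]; decide)
  -- Here `s` closes the path to a heptagon. It may still be adjacent to `x 2` or `x 3`, which is
  -- why `not_heptagon` uses only non-edges at distance two.
  have D8 : Compar s (x 0) → Compar s (x 5) → ¬ Compar s (x 1) → Compar s (x 4) := by
    intro h0 h5 h1
    by_contra h4
    exact not_heptagon h0 ((hx 0 1).2 (by decide)) ((hx 1 2).2 (by decide))
      ((hx 2 3).2 (by decide)) ((hx 3 4).2 (by decide)) ((hx 4 5).2 (by decide)) h5.symm h1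
      (by rw [hx]; decide) (by rw [hx]; decide) (by rw [hx]; decide) (by rw [hx]; decide)
      (fun h => h4 h.symm) (by rw [hx]; decide)
  simp only [Fin.sum_univ_six] at hlt
  clear hinj hs hx hmin h4 hv
  simp at hlt
  -- A finite Boolean check on the six adjacencies of `s`.
  grind

end Triples

/-! ### Exclusion of two seven-point configurations -/

section Configurations

set_option linter.unusedSectionVars false

variable {S : Type*} [Fintype S] [PartialOrder S]

/-- Adjacency of the path with seven vertices and one chord between the neighbours of the central
vertex. -/
def chordAdj (i j : Fin 7) : Prop :=
  ((i : ℕ) ≤ j + 1 ∧ (j : ℕ) ≤ i + 1) ∨ (i = 2 ∧ j = 4) ∨ (i = 4 ∧ j = 2)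

instance : DecidableRel chordAdj := fun _ _ => inferInstanceAs (Decidable (_ ∨ _))

/-- As for the path, with weights `(3, 2, 1, 3, 1, 2, 3) / 8` of total `15/8`; the cheaper triples
used have sizes 3, 2, 1 and cost `13/12`. -/
lemma UtmostData.not_chord {v : S → ℝ} (hv : UtmostData v) (h4 : NoFour S)
    (hmin : MinCost S (7 / 6)) (x : Fin 7 → S)
    (hx : ∀ i j, Compar (x i) (x j) ↔ chordAdj i j) : False := by
  classical
  have hinj : Function.Injective x := by
    intro i j hij
    exact (by decide : ∀ i j, (∀ k, chordAdj i k ↔ chordAdj j k) → i = j) i j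
      fun k => by rw [← hx, ← hx, hij]
  have hw : ∀ i : Fin 7, ![3, 2, 1, 3, 1, 2, 3] i + ∑ j : Fin 7, ![3, 2, 1, 3, 1, 2, 3] j *
      (if chordAdj i j then 1 else 0) = 8 := by decide
  have hrow : ∀ i : Fin 7, ![3, 2, 1, 3, 1, 2, 3] i + ∑ j : Fin 7, ![3, 2, 1, 3, 1, 2, 3] j *
      (if Compar (x i) (x j) then 1 else 0) = 8 := by
    intro i
    rw [← hw i]
    simp only [hx]
  clear hw
  obtain ⟨s, hs, hlt⟩ := hv.points_grow x ![3, 2, 1, 3, 1, 2, 3] 8 hinj hrow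
    (by decide) (by decide)
  have E : ∀ i j k, ¬ chordAdj i j → ¬ chordAdj i k → ¬ chordAdj j k →
      Compar s (x i) ∨ Compar s (x j) ∨ Compar s (x k) := by
    intro i j k hij hik hjk
    by_contra! h
    exact hjk ((hx _ _).1 (h4 s (x i) (x j) (x k) h.1 h.2.1 h.2.2 (by rwa [hx]) (by rwa [hx])))
  have E1 := E 0 2 5 (by decide) (by decide) (by decide)
  have E2 := E 0 2 6 (by decide) (by decide) (by decide)
  have E3 := E 0 3 5 (by decide) (by decide) (by decide)
  have E4 := E 0 3 6 (by decide) (by decide) (by decide)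
  have E5 := E 0 4 6 (by decide) (by decide) (by decide)
  have E6 := E 1 3 5 (by decide) (by decide) (by decide)
  have E7 := E 1 3 6 (by decide) (by decide) (by decide)
  have E8 := E 1 4 6 (by decide) (by decide) (by decide)
  have T : ∀ i j k l m : Fin 7, i ≠ j → k ≠ l → chordAdj i j → chordAdj k l →
      ¬ chordAdj i k → ¬ chordAdj i l → ¬ chordAdj j k → ¬ chordAdj j l → ¬ chordAdj i m →
      ¬ chordAdj j m → ¬ chordAdj k m → ¬ chordAdj l m → Compar s (x i) → Compar s (x j) →
      ¬ Compar s (x k) → ¬ Compar s (x l) → Compar s (x m) := by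
    intro i j k l m hij hkl
    simp only [← hx]
    intros
    by_contra
    refine hmin.not_triple_321 (by norm_num) (p := s) (q := x i) (r := x j) (t := x k) (u := x l)
      (w := x m) (hs _) (hs _) (hinj.ne hij) (hinj.ne hkl) ?_ ?_ ?_ ?_ ?_ ?_ ?_ ?_ ?_ ?_ ?_ ?_ ?_
      ?_ ?_ <;> assumption
  have D1 := T 2 3 5 6 0 (by decide) (by decide) (by decide) (by decide) (by decide) (by decide)
    (by decide) (by decide) (by decide) (by decide) (by decide) (by decide)
  have D2 := T 0 1 5 6 3 (by decide) (by decide) (by decide) (by decide) (by decide) (by decide)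
    (by decide) (by decide) (by decide) (by decide) (by decide) (by decide)
  have D3 := T 0 1 3 4 6 (by decide) (by decide) (by decide) (by decide) (by decide) (by decide)
    (by decide) (by decide) (by decide) (by decide) (by decide) (by decide)
  have D4 := T 4 3 1 0 6 (by decide) (by decide) (by decide) (by decide) (by decide) (by decide)
    (by decide) (by decide) (by decide) (by decide) (by decide) (by decide)
  have D5 := T 6 5 1 0 3 (by decide) (by decide) (by decide) (by decide) (by decide) (by decide)
    (by decide) (by decide) (by decide) (by decide) (by decide) (by decide)
  have D6 := T 6 5 3 2 0 (by decide) (by decide) (by decide) (by decide) (by decide) (by decide)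
    (by decide) (by decide) (by decide) (by decide) (by decide) (by decide)
  have D7 : Compar s (x 0) → Compar s (x 3) → ¬ Compar s (x 1) → Compar s (x 2) := by
    intro h0 h3 h1
    by_contra h2
    exact not_pentagon h0 ((hx 0 1).2 (by decide)) ((hx 1 2).2 (by decide))
      ((hx 2 3).2 (by decide)) h3.symm h1 (by rw [hx]; decide) (by rw [hx]; decide)
      (fun h => h2 h.symm) (by rw [hx]; decide)
  have D8 : Compar s (x 6) → Compar s (x 3) → ¬ Compar s (x 5) → Compar s (x 4) := by
    intro h0 h3 h1
    by_contra h2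
    exact not_pentagon h0 ((hx 6 5).2 (by decide)) ((hx 5 4).2 (by decide))
      ((hx 4 3).2 (by decide)) h3.symm h1 (by rw [hx]; decide) (by rw [hx]; decide)
      (fun h => h2 h.symm) (by rw [hx]; decide)
  simp only [Fin.sum_univ_seven] at hlt
  clear hrow hinj hs hx hmin h4 hv E T
  simp at hlt
  grind

lemma MinCost.not_triple_421 {c : ℝ} (hmin : MinCost S c) (hc : 31 / 30 < c) {o p q r t u w : S}
    (hop : o ≠ p) (hoq : o ≠ q) (hor : o ≠ r)
    (hpq : p ≠ q) (hpr : p ≠ r) (hqr : q ≠ r) (htu : t ≠ u) (cop : Compar o p) (coq : Compar o q)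
    (cor : Compar o r) (cpq : Compar p q) (cpr : Compar p r)
    (cqr : Compar q r) (ctu : Compar t u) (not : ¬ Compar o t) (nou : ¬ Compar o u)
    (now : ¬ Compar o w)
    (npt : ¬ Compar p t) (nqt : ¬ Compar q t) (nrt : ¬ Compar r t)
    (npu : ¬ Compar p u) (nqu : ¬ Compar q u) (nru : ¬ Compar r u)
    (npw : ¬ Compar p w) (nqw : ¬ Compar q w) (nrw : ¬ Compar r w)
    (ntw : ¬ Compar t w) (nuw : ¬ Compar u w) : False := by
  classical
  have hcl : Clique (insert o {p, q, r} : Finset S) := by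
    grind [Clique, Compar.symm, Compar.refl]
  have h := hmin (insert o {p, q, r}) {t, u} {w} ⟨hcl, clique_pair ctu,
    clique_singleton _, by grind [Separate, Apart], by grind [Separate, Apart],
    by grind [Separate, Apart], by simp, by simp, by simp⟩
  rw [tripleCost, card_insert_of_notMem (by simp [*]), card_three hpq hpr hqr, card_pair htu] at h
  norm_num at h
  linarith

lemma MinCost.not_triple_222 {c : ℝ} (hmin : MinCost S c) (hc : 1 < c) {p q r t u w : S}
    (hpq : p ≠ q) (hrt : r ≠ t) (huw : u ≠ w) (cpq : Compar p q) (crt : Compar r t)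
    (cuw : Compar u w) (npr : ¬ Compar p r) (npt : ¬ Compar p t) (npu : ¬ Compar p u)
    (npw : ¬ Compar p w) (nqr : ¬ Compar q r) (nqt : ¬ Compar q t) (nqu : ¬ Compar q u)
    (nqw : ¬ Compar q w) (nru : ¬ Compar r u) (nrw : ¬ Compar r w) (ntu : ¬ Compar t u)
    (ntw : ¬ Compar t w) : False := by
  classical
  have h := hmin {p, q} {r, t} {u, w} ⟨clique_pair cpq, clique_pair crt,
    clique_pair cuw, by grind [Separate, Apart], by grind [Separate, Apart],
    by grind [Separate, Apart], by simp, by simp, by simp⟩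
  rw [tripleCost, card_pair hpq, card_pair hrt, card_pair huw] at h
  norm_num at h
  linarith

lemma apart_three [DecidableEq S] {s p q r : S} (hp : ¬ Compar s p) (hq : ¬ Compar s q)
    (hr : ¬ Compar s r) : Apart s ({p, q, r} : Finset S) := by
  simp [Apart, hp, hq, hr]

/-- Adjacency of two triangles joined by an edge, together with an isolated vertex. -/
def trianglesAdj (i j : Fin 7) : Prop :=
  i = j ∨ (i ≤ 2 ∧ j ≤ 2) ∨ ((3 ≤ i ∧ i ≤ 5) ∧ (3 ≤ j ∧ j ≤ 5)) ∨ (i = 2 ∧ j = 3) ∨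
    (i = 3 ∧ j = 2)

instance : DecidableRel trianglesAdj := fun _ _ => inferInstanceAs (Decidable (_ ∨ _))

/-- The weights `(4, 4, 2, 2, 4, 4, 7) / 14` have total `27/14 < 2`. Besides cheaper triples, a new
point could create a four-point path with a separate three-element chain, which `hK` forbids.
Injectivity is assumed because the graph has twin vertices. -/
lemma UtmostData.not_triangles {v : S → ℝ} (hv : UtmostData v) (h4 : NoFour S)
    (hmin : MinCost S (13 / 12)) (hK : ∀ a b c d : S, ∀ C : Finset S, KConfig a b c d C → #C ≠ 3)
    (x : Fin 7 → S) (hinj : Function.Injective x)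
    (hx : ∀ i j, Compar (x i) (x j) ↔ trianglesAdj i j) : False := by
  classical
  have hw : ∀ i : Fin 7, ![4, 4, 2, 2, 4, 4, 7] i + ∑ j : Fin 7, ![4, 4, 2, 2, 4, 4, 7] j *
      (if trianglesAdj i j then 1 else 0) = 14 := by decide
  have hrow : ∀ i : Fin 7, ![4, 4, 2, 2, 4, 4, 7] i + ∑ j : Fin 7, ![4, 4, 2, 2, 4, 4, 7] j *
      (if Compar (x i) (x j) then 1 else 0) = 14 := by
    intro i
    rw [← hw i]
    simp only [hx]
  clear hw
  obtain ⟨s, hs, hlt⟩ := hv.points_grow x ![4, 4, 2, 2, 4, 4, 7] 14 hinj hrow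
    (by decide) (by decide)
  have E : ∀ i j, ¬ trianglesAdj i j → ¬ trianglesAdj i 6 → ¬ trianglesAdj j 6 →
      Compar s (x i) ∨ Compar s (x j) ∨ Compar s (x 6) := by
    intro i j hij hik hjk
    by_contra! h
    exact hjk ((hx _ _).1 (h4 s (x i) (x j) (x 6) h.1 h.2.1 h.2.2 (by rwa [hx]) (by rwa [hx])))
  have E1 := E 0 3 (by decide) (by decide) (by decide)
  have E2 := E 0 4 (by decide) (by decide) (by decide)
  have E3 := E 0 5 (by decide) (by decide) (by decide)
  have E4 := E 1 3 (by decide) (by decide) (by decide)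
  have E5 := E 1 4 (by decide) (by decide) (by decide)
  have E6 := E 1 5 (by decide) (by decide) (by decide)
  have E7 := E 2 4 (by decide) (by decide) (by decide)
  have E8 := E 2 5 (by decide) (by decide) (by decide)
  have T : ∀ i j k l : Fin 7, i ≠ j → k ≠ l → trianglesAdj i j → trianglesAdj k l →
      ¬ trianglesAdj i k → ¬ trianglesAdj i l → ¬ trianglesAdj j k → ¬ trianglesAdj j l →
      ¬ trianglesAdj 6 i → ¬ trianglesAdj 6 j → ¬ trianglesAdj 6 k → ¬ trianglesAdj 6 l →
      Compar s (x 6) → ¬ Compar s (x i) → ¬ Compar s (x j) →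
      ¬ Compar s (x k) → Compar s (x l) := by
    intro i j k l hij hkl
    simp only [← hx]
    intros
    by_contra
    refine hmin.not_triple_222 (by norm_num) (p := s) (q := x 6) (r := x i) (t := x j) (u := x k)
      (w := x l) (hs _) (hinj.ne hij) (hinj.ne hkl) ?_ ?_ ?_ ?_ ?_ ?_ ?_ ?_ ?_ ?_ ?_ ?_ ?_
      ?_ ?_ <;> assumption
  have D1 := T 0 1 4 5 (by decide) (by decide) (by decide) (by decide) (by decide) (by decide)
    (by decide) (by decide) (by decide) (by decide) (by decide) (by decide)
  have D2 := T 0 2 4 5 (by decide) (by decide) (by decide) (by decide) (by decide) (by decide)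
    (by decide) (by decide) (by decide) (by decide) (by decide) (by decide)
  have D3 := T 1 2 4 5 (by decide) (by decide) (by decide) (by decide) (by decide) (by decide)
    (by decide) (by decide) (by decide) (by decide) (by decide) (by decide)
  have D4 := T 0 1 3 4 (by decide) (by decide) (by decide) (by decide) (by decide) (by decide)
    (by decide) (by decide) (by decide) (by decide) (by decide) (by decide)
  have D5 := T 0 1 3 5 (by decide) (by decide) (by decide) (by decide) (by decide) (by decide)
    (by decide) (by decide) (by decide) (by decide) (by decide) (by decide)
  have K : ∀ i j k l m : Fin 7, k ≠ l → k ≠ m → l ≠ m → trianglesAdj i j → ¬ trianglesAdj i 6 →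
      ¬ trianglesAdj j 6 → trianglesAdj k l → trianglesAdj k m → trianglesAdj l m →
      ¬ trianglesAdj i k → ¬ trianglesAdj i l → ¬ trianglesAdj i m →
      ¬ trianglesAdj j k → ¬ trianglesAdj j l → ¬ trianglesAdj j m →
      ¬ trianglesAdj 6 k → ¬ trianglesAdj 6 l → ¬ trianglesAdj 6 m →
      Compar s (x 6) → Compar s (x i) → ¬ Compar s (x j) → ¬ Compar s (x k) →
      ¬ Compar s (x l) → Compar s (x m) := by
    intro i j k l m hkl hkm hlm
    simp only [← hx]
    intro hij hi6 hj6 ckl ckm clm nik nil nim njk njl njm n6k n6l n6m hs6 hsi hsj hsk hsl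
    by_contra hsm
    refine hK (x i) (x j) (x 6) s {x k, x l, x m}
      { hab := hij, hcd := hs6.symm, had := hsi.symm, hac := hi6, hbc := hj6,
        hbd := fun h => hsj h.symm, clique := clique_three ckl ckm clm,
        ha := apart_three nik nil nim, hb := apart_three njk njl njm,
        hc := apart_three n6k n6l n6m, hd := apart_three hsk hsl hsm }
      (card_three (hinj.ne hkl) (hinj.ne hkm) (hinj.ne hlm))
  have K1 := K 0 1 3 4 5 (by decide) (by decide) (by decide) (by decide) (by decide) (by decide)
    (by decide) (by decide) (by decide) (by decide) (by decide) (by decide) (by decide) (by decide)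
    (by decide) (by decide) (by decide) (by decide)
  have K2 := K 1 0 3 4 5 (by decide) (by decide) (by decide) (by decide) (by decide) (by decide)
    (by decide) (by decide) (by decide) (by decide) (by decide) (by decide) (by decide) (by decide)
    (by decide) (by decide) (by decide) (by decide)
  have K3 := K 4 5 0 1 2 (by decide) (by decide) (by decide) (by decide) (by decide) (by decide)
    (by decide) (by decide) (by decide) (by decide) (by decide) (by decide) (by decide) (by decide)
    (by decide) (by decide) (by decide) (by decide)
  have K4 := K 5 4 0 1 2 (by decide) (by decide) (by decide) (by decide) (by decide) (by decide)
    (by decide) (by decide) (by decide) (by decide) (by decide) (by decide) (by decide) (by decide)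
    (by decide) (by decide) (by decide) (by decide)
  have G : ∀ i j k l m : Fin 7, i ≠ j → i ≠ k → j ≠ k → l ≠ m → trianglesAdj i j →
      trianglesAdj i k → trianglesAdj j k → trianglesAdj l m →
      ¬ trianglesAdj i l → ¬ trianglesAdj i m → ¬ trianglesAdj j l → ¬ trianglesAdj j m →
      ¬ trianglesAdj k l → ¬ trianglesAdj k m → ¬ trianglesAdj i 6 → ¬ trianglesAdj j 6 →
      ¬ trianglesAdj k 6 → ¬ trianglesAdj l 6 → ¬ trianglesAdj m 6 → ¬ Compar s (x 6) →
      Compar s (x i) → Compar s (x j) → Compar s (x k) → ¬ Compar s (x l) → Compar s (x m) := by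
    intro i j k l m hij hik hjk hlm
    simp only [← hx]
    intro cij cik cjk clm nil nim njl njm nkl nkm ni6 nj6 nk6 nl6 nm6 hs6 hsi hsj hsk hsl
    by_contra hsm
    exact hmin.not_triple_421 (by norm_num) (hs i) (hs j) (hs k) (hinj.ne hij) (hinj.ne hik)
      (hinj.ne hjk) (hinj.ne hlm) hsi hsj hsk cij cik cjk clm hsl hsm hs6 nil njl nkl nim njm nkm
      ni6 nj6 nk6 nl6 nm6
  have G1 := G 3 4 5 0 1 (by decide) (by decide) (by decide) (by decide) (by decide) (by decide)
    (by decide) (by decide) (by decide) (by decide) (by decide) (by decide) (by decide) (by decide)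
    (by decide) (by decide) (by decide) (by decide) (by decide)
  have G2 := G 0 1 2 4 5 (by decide) (by decide) (by decide) (by decide) (by decide) (by decide)
    (by decide) (by decide) (by decide) (by decide) (by decide) (by decide) (by decide) (by decide)
    (by decide) (by decide) (by decide) (by decide) (by decide)
  simp only [Fin.sum_univ_seven] at hlt
  clear hrow hinj hs hx hmin h4 hv E T K G hK
  simp at hlt
  grind

end Configurations

/-! ### A four-point path with a separate chain -/

section KGrowth

set_option linter.unusedSectionVars false
set_option linter.unnecessarySeqFocus false

variable {S : Type*} [Fintype S] [PartialOrder S]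

/-- Otherwise `s`, `a`, `b` and an element of `C` missed by `s` would form a four-element antichain.
-/
lemma NoFour.exists_compar (h4 : NoFour S) {a b : S} {C : Finset S} {s : S}
    (hlt : comparCount C s < #C) (hab : ¬ Compar a b) (ha : Apart a C) (hb : Apart b C) :
    Compar s a ∨ Compar s b := by
  by_contra! h
  refine hlt.ne (comparCount_eq_card_iff.2 fun c hc => ?_)
  by_contra hsc
  exact hb c hc (h4 s a b c h.1 h.2 hsc hab (ha c hc))

lemma Triple.le_of_cards {A B C : Finset S} {c : ℝ} (hmin : MinCost S c) (h : Triple A B C)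
    {l m n : ℕ} (hl : #A = l) (hm : #B = m) (hn : #C = n) :
    c ≤ 1 / (l + 1) + 1 / (m + 1) + 1 / (n + 1) := by
  have := hmin A B C h
  rwa [tripleCost, hl, hm, hn] at this

lemma Apart.insert_left [DecidableEq S] {A B : Finset S} {s : S} (hs : Apart s B)
    (h : Separate A B) : Separate (insert s A) B := by
  grind [Separate]

lemma Clique.insert [DecidableEq S] {A : Finset S} {s : S} (h : Clique A)
    (hs : ∀ a ∈ A, Compar s a) : Clique (insert s A) := by
  grind [Clique, Compar.symm, Compar.refl]

section

variable {a b c d : S} {C : Finset S}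

lemma KConfig.ne_ab (h : KConfig a b c d C) : a ≠ b := fun e => h.hbd (e ▸ h.had)
lemma KConfig.ne_ac (h : KConfig a b c d C) : a ≠ c := fun e => h.hac (e ▸ Compar.refl _)
lemma KConfig.ne_ad (h : KConfig a b c d C) : a ≠ d := fun e => h.hbd (e ▸ h.hab.symm)
lemma KConfig.ne_bc (h : KConfig a b c d C) : b ≠ c := fun e => h.hbc (e ▸ Compar.refl _)
lemma KConfig.ne_bd (h : KConfig a b c d C) : b ≠ d := fun e => h.hbd (e ▸ Compar.refl _)
lemma KConfig.ne_cd (h : KConfig a b c d C) : c ≠ d := fun e => h.hac (e ▸ h.had)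

lemma Apart.notMem {A : Finset S} {s : S} (h : Apart s A) : s ∉ A :=
  fun hs => h s hs (Compar.refl s)

open Classical in
/-- The growth alternative for a path with four vertices and a separate chain. -/
lemma UtmostData.kConfig_cover_or_grow {v : S → ℝ} (hv : UtmostData v) (h : KConfig a b c d C)
    (hC : C.Nonempty) :
    ((∀ s, s = a ∨ s = b ∨ s = c ∨ s = d ∨ s ∈ C) ∧ 4 ≤ #C) ∨
      (#C ≤ 4 ∧ ∃ s, s ≠ a ∧ s ≠ b ∧ s ≠ c ∧ s ≠ d ∧ s ∉ C ∧
        (#C + 1) * ((if Compar s a then 1 else 0) + 2 * (if Compar s b then 1 else 0) +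
          2 * (if Compar s c then 1 else 0) + if Compar s d then 1 else 0) +
          5 * comparCount C s < 5 * (#C + 1)) := by
  have hab := h.ne_ab
  have hac := h.ne_ac
  have had := h.ne_ad
  have hbc := h.ne_bc
  have hbd := h.ne_bd
  have hcd := h.ne_cd
  have haC := h.ha.notMem
  have hbC := h.hb.notMem
  have hcC := h.hc.notMem
  have hdC := h.hd.notMem
  have hn : (0 : ℝ) < #C := by exact_mod_cast card_pos.2 hC
  set n := #C with hn_def
  -- These weights solve the gradient equations on the path and on the chain. Their total `6/5 +
  -- n/(n+1)` reaches 2 exactly at `n = 4`.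
  set w : Fin 5 → ℝ := ![1 / 5, 2 / 5, 2 / 5, 1 / 5, 1 / (n + 1)] with hw
  set F : Fin 5 → Finset S := ![{a}, {b}, {c}, {d}, C] with hF
  have hdis : ∀ i j, i ≠ j → Disjoint (F i) (F j) := by
    have : ∀ i j, i < j → Disjoint (F i) (F j) := by
      simp [F, Fin.forall_fin_succ, hab.symm, hac.symm, had.symm, hbc.symm, hbd.symm, hcd.symm,
        haC, hbC, hcC, hdC]
    intro i j hij
    rcases lt_or_gt_of_ne hij with h | h
    · exact this i j h
    · exact (this j i h).symm
  have hrow : ∀ i, ∀ t ∈ F i, w i + ∑ j, w j * (comparCount (F j) t : ℝ) = 1 := by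
    have hca : ¬ Compar c a := fun h' => h.hac h'.symm
    have hcb : ¬ Compar c b := fun h' => h.hbc h'.symm
    have hdb : ¬ Compar d b := fun h' => h.hbd h'.symm
    have e1 := comparCount_eq_zero_iff.2 h.ha
    have e2 := comparCount_eq_zero_iff.2 h.hb
    have e3 := comparCount_eq_zero_iff.2 h.hc
    have e4 := comparCount_eq_zero_iff.2 h.hd
    intro i
    fin_cases i
    · intro t ht
      obtain rfl : t = a := by simpa [hF] using ht
      norm_num [hF, hw, Fin.sum_univ_succ, comparCount_singleton, Compar.refl, h.hab, h.had, h.hac,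
        e1]
    · intro t ht
      obtain rfl : t = b := by simpa [hF] using ht
      norm_num [hF, hw, Fin.sum_univ_succ, comparCount_singleton, Compar.refl, h.hab.symm, h.hbc,
        h.hbd, e2]
    · intro t ht
      obtain rfl : t = c := by simpa [hF] using ht
      norm_num [hF, hw, Fin.sum_univ_succ, comparCount_singleton, Compar.refl, h.hcd, hca, hcb, e3]
    · intro t ht
      obtain rfl : t = d := by simpa [hF] using ht
      norm_num [hF, hw, Fin.sum_univ_succ, comparCount_singleton, Compar.refl, h.hcd.symm,
        h.had.symm, hdb, e4]
    · intro t ht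
      replace ht : t ∈ C := ht
      have e5 := comparCount_of_clique h.clique ht
      have na : ¬ Compar t a := fun h' => h.ha t ht h'.symm
      have nb : ¬ Compar t b := fun h' => h.hb t ht h'.symm
      have nc : ¬ Compar t c := fun h' => h.hc t ht h'.symm
      have nd : ¬ Compar t d := fun h' => h.hd t ht h'.symm
      simp [hF, hw, Fin.sum_univ_succ, comparCount_singleton, na, nb, nc, nd, e5, ← hn_def]
      field_simp
      ring
  have hcard : ∑ i, w i * (#(F i) : ℝ) = 6 / 5 + n / (n + 1) := by
    simp [hF, hw, Fin.sum_univ_succ, ← hn_def]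
    ring
  have hw0 : ∀ i, 0 ≤ w i := by
    have h0 : (0 : ℝ) ≤ 1 / (n + 1) := by positivity
    intro i
    fin_cases i
    · norm_num [hw]
    · norm_num [hw]
    · norm_num [hw]
    · norm_num [hw]
    · exact h0
  rcases hv.cover_or_grow w F hw0 hdis hrow (by rw [hcard]; positivity) with
    ⟨hcov, h2⟩ | ⟨h2, s, hs, hlt⟩
  · left
    refine ⟨fun s => ?_, ?_⟩
    · obtain ⟨i, hi⟩ := hcov s
      fin_cases i <;> simp [hF] at hi <;> tauto
    · rw [hcard] at h2
      have : 4 / 5 ≤ (n : ℝ) / (n + 1) := by linarith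
      rw [le_div_iff₀ (by positivity)] at this
      have : (4 : ℝ) ≤ n := by linarith
      exact_mod_cast this
  · right
    refine ⟨?_, s, by simpa [hF] using hs 0, by simpa [hF] using hs 1, by simpa [hF] using hs 2,
      by simpa [hF] using hs 3, hs 4, ?_⟩
    · rw [hcard] at h2
      have : (n : ℝ) / (n + 1) ≤ 4 / 5 := by linarith
      rw [div_le_iff₀ (by positivity)] at this
      have : (n : ℝ) ≤ 4 := by linarith
      exact_mod_cast this
    · simp only [hF, hw, Fin.sum_univ_five] at hlt
      have h' : ((1 / 5 * (if Compar s a then 1 else 0) + 2 / 5 * (if Compar s b then 1 else 0) +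
          2 / 5 * (if Compar s c then 1 else 0) + 1 / 5 * (if Compar s d then 1 else 0) +
          1 / (n + 1) * comparCount C s : ℝ)) < 1 := by
        simpa [comparCount_singleton] using hlt
      have h'' : ((n + 1) * ((if Compar s a then 1 else 0) + 2 * (if Compar s b then 1 else 0) +
          2 * (if Compar s c then 1 else 0) + if Compar s d then 1 else 0) +
          5 * comparCount C s : ℝ) < 5 * (n + 1) := by
        have hp : (0 : ℝ) < 5 * (n + 1) := by positivity
        have := mul_lt_mul_of_pos_left h' hp
        rw [mul_one] at this
        refine lt_of_eq_of_lt ?_ this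
        field_simp
      exact_mod_cast h''

/-- This triple has a chain one longer than `C`, hence beats the cost `1/2 + 1/3 + 1/(#C + 1)`; it
rules out points adjacent to all of `C` and to none of `a`, `b`, `c`. -/
lemma KConfig.pair_triple [DecidableEq S] (h : KConfig a b c d C) {s : S}
    (hsC : ∀ t ∈ C, Compar s t) (ha : ¬ Compar s a) (hb : ¬ Compar s b) (hc : ¬ Compar s c) :
    Triple (insert s C) {a, b} {c} where
  cliqueA := h.clique.insert hsC
  cliqueB := clique_pair h.hab
  cliqueC := clique_singleton c
  sepAB := Apart.insert_left (by simp [Apart, ha, hb]) fun t ht => by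
    have h1 : ¬ Compar t a := fun h' => h.ha t ht h'.symm
    have h2 : ¬ Compar t b := fun h' => h.hb t ht h'.symm
    simp [Apart, h1, h2]
  sepAC := Apart.insert_left (by simp [Apart, hc]) fun t ht => by
    have h1 : ¬ Compar t c := fun h' => h.hc t ht h'.symm
    simp [Apart, h1]
  sepBC := by
    have h1 := h.hac
    have h2 := h.hbc
    simp [Separate, Apart, h1, h2]
  neA := insert_nonempty _ _
  neB := insert_nonempty _ _
  neC := singleton_nonempty _

lemma compar_iff_of_lt {m : ℕ} (x : Fin m → S) (adj : Fin m → Fin m → Prop)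
    (hrefl : ∀ i, adj i i) (hsymm : ∀ i j, adj i j ↔ adj j i)
    (h : ∀ i j, i < j → (Compar (x i) (x j) ↔ adj i j)) (i j : Fin m) :
    Compar (x i) (x j) ↔ adj i j := by
  rcases lt_trichotomy i j with hij | hij | hij
  · exact h i j hij
  · subst hij
    exact iff_of_true (Compar.refl _) (hrefl i)
  · rw [compar_comm, hsymm]
    exact h j i hij

/-- The points `t, s, b, a, d, c` form an induced six-point path. -/
lemma KConfig.not_pendant {v : S → ℝ} (hv : UtmostData v) (h4 : NoFour S)
    (hmin : MinCost S (4 / 3)) (h : KConfig a b c d C) {s t : S} (ht : t ∈ C) (hst : Compar s t)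
    (ha : ¬ Compar s a) (hb : Compar s b) (hc : ¬ Compar s c) (hd : ¬ Compar s d) : False := by
  have t1 := fun h' : Compar t a => h.ha t ht h'.symm
  have t2 := fun h' : Compar t b => h.hb t ht h'.symm
  have t3 := fun h' : Compar t c => h.hc t ht h'.symm
  have t4 := fun h' : Compar t d => h.hd t ht h'.symm
  have k1 := h.hab.symm
  have k2 := h.hcd.symm
  have k3 := h.had
  have k4 := h.hac
  have k5 := h.hbc
  have k6 := h.hbd
  have hst' := hst.symm
  refine hv.not_path h4 hmin ![t, s, b, a, d, c]
    (compar_iff_of_lt _ _ (by decide) (by decide) fun i j hij => ?_)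
  fin_cases i <;> fin_cases j <;>
  first
  | exact absurd hij (by decide)
  | exact iff_of_true (by assumption) (by decide)
  | exact iff_of_false (by assumption) (by decide)

open Classical in
-- If `s` misses `C`, the chains `{s, a, b}`, `{c}`, `C` are cheaper. Otherwise `s` has a single
-- neighbour `e` in `C` and does not meet `d`, and `{s, b}`, `{c, d}`, `C \ {e}` are cheaper unless
-- `#C = 2`, which is the chord configuration.
lemma KConfig.not_partial {v : S → ℝ} (hv : UtmostData v) (h4 : NoFour S) (h : KConfig a b c d C)
    (hC4 : #C ≤ 4) (hmin : MinCost S (1 / 2 + 1 / 3 + 1 / (#C + 1))) {s : S}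
    (hsa : s ≠ a) (hsb : s ≠ b)
    (ha : Compar s a) (hb : Compar s b) (hc : ¬ Compar s c) (hlt : comparCount C s < #C)
    (hbound : (#C + 1) * (3 + if Compar s d then 1 else 0) + 5 * comparCount C s
      < 5 * (#C + 1)) : False := by
  have cab := h.hab
  have nac := h.hac
  have nbc := h.hbc
  have nbd := h.hbd
  have neC : C.Nonempty := card_pos.1 (by omega)
  rcases Nat.eq_zero_or_pos (comparCount C s) with h0 | h0
  · have h0' := comparCount_eq_zero_iff.1 h0
    have hT : Triple {s, a, b} {c} C :=
      { cliqueA := clique_three ha hb cab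
        cliqueB := clique_singleton c
        cliqueC := h.clique
        sepAB := by simp [Separate, Apart, hc, nac, nbc]
        sepAC := by
          have h1 := h.ha
          have h2 := h.hb
          simp [Separate, h0', h1, h2]
        sepBC := by
          have h1 := h.hc
          simp [Separate, h1]
        neA := insert_nonempty _ _
        neB := singleton_nonempty _
        neC := neC }
    have := Triple.le_of_cards hmin hT (card_three hsa hsb h.ne_ab) (card_singleton c) rfl
    norm_num at this
  · have hd : ¬ Compar s d := by
      intro hd
      simp only [hd, if_true] at hbound
      omega
    simp only [hd, if_false] at hbound
    -- The bound is now `5k < 2(#C + 1) ≤ 10`; with `k = 1` it also gives `#C ≥ 2`.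
    have h1 : comparCount C s = 1 := by omega
    obtain ⟨e, heC⟩ := card_eq_one.1 h1
    have he : e ∈ C ∧ Compar s e := by
      have : e ∈ ({t ∈ C | Compar s t} : Finset S) := heC ▸ mem_singleton_self e
      simpa using this
    have hne : ∀ t ∈ C, t ≠ e → ¬ Compar s t := by
      intro t ht hte hst
      have : t ∈ ({t ∈ C | Compar s t} : Finset S) := by simp [ht, hst]
      rw [heC, mem_singleton] at this
      exact hte this
    have hT : Triple {s, b} {c, d} (C.erase e) :=
      { cliqueA := clique_pair hb
        cliqueB := clique_pair h.hcd
        cliqueC := h.clique.mono (erase_subset _ _)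
        sepAB := by simp [Separate, Apart, hc, hd, nbc, nbd]
        sepAC := by
          refine Apart.insert_left (fun t ht => hne t (mem_of_mem_erase ht) (ne_of_mem_erase ht)) ?_
          have h1 := h.hb
          intro x hx t ht
          rw [mem_singleton] at hx
          subst hx
          exact h1 t (mem_of_mem_erase ht)
        sepBC := by
          have h1 := h.hc
          have h2 := h.hd
          refine Apart.insert_left (fun t ht => h1 t (mem_of_mem_erase ht)) ?_
          intro x hx t ht
          rw [mem_singleton] at hx
          subst hx
          exact h2 t (mem_of_mem_erase ht)
        neA := insert_nonempty _ _
        neB := insert_nonempty _ _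
        neC := card_pos.1 (by rw [card_erase_of_mem he.1]; omega) }
    have hcost := Triple.le_of_cards hmin hT (card_pair hsb) (card_pair h.ne_cd)
      (card_erase_of_mem he.1)
    obtain hn | hn | hn : #C = 2 ∨ #C = 3 ∨ #C = 4 := by omega
    · obtain ⟨f, hf⟩ : ∃ f, C.erase e = {f} :=
        card_eq_one.1 (by rw [card_erase_of_mem he.1, hn])
      have hfC : f ∈ C ∧ f ≠ e := by
        have : f ∈ C.erase e := hf ▸ mem_singleton_self f
        exact ⟨mem_of_mem_erase this, ne_of_mem_erase this⟩
      have u1 := h.ha e he.1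
      have u2 := h.hb e he.1
      have u3 := h.hc e he.1
      have u4 := h.hd e he.1
      have w1 := h.ha f hfC.1
      have w2 := h.hb f hfC.1
      have w3 := h.hc f hfC.1
      have w4 := h.hd f hfC.1
      have se := he.2
      have sf := hne f hfC.1 hfC.2
      have ef := h.clique e he.1 f hfC.1
      have cd := h.hcd
      have da := h.had.symm
      have ca := fun h' : Compar c a => nac h'.symm
      have cb := fun h' : Compar c b => nbc h'.symm
      have cs := fun h' : Compar c s => hc h'.symm
      have db := fun h' : Compar d b => nbd h'.symm
      have ds := fun h' : Compar d s => hd h'.symm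
      have as := ha.symm
      have bs := hb.symm
      rw [hn] at hmin
      norm_num at hmin
      refine hv.not_chord h4 hmin ![c, d, a, b, s, e, f]
        (compar_iff_of_lt _ _ (by decide) (by decide) fun i j hij => ?_)
      fin_cases i <;> fin_cases j <;>
      first
      | exact absurd hij (by decide)
      | exact iff_of_true (by assumption) (by decide)
      | exact iff_of_false (by assumption) (by decide)
    · rw [hn] at hcost
      norm_num at hcost
    · rw [hn] at hcost
      norm_num at hcost

/-- A further point of gradient below 1 would create a pentagon, a net, a six-point path, the chord
configuration or a triple of smaller cost. So the configuration fills `S`, and the total weight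
being at least 2 forces `#C ≥ 4`. -/
lemma KConfig.cover {v : S → ℝ} (hv : UtmostData v) (h4 : NoFour S) (h : KConfig a b c d C)
    (hC : C.Nonempty) (hmin : MinCost S (1 / 2 + 1 / 3 + 1 / (#C + 1))) :
    (∀ s, s = a ∨ s = b ∨ s = c ∨ s = d ∨ s ∈ C) ∧ 4 ≤ #C := by
  classical
  rcases hv.kConfig_cover_or_grow h hC with h' | ⟨hC4, s, hsa, hsb, hsc, hsd, hsC, hlt⟩
  · exact h'
  exfalso
  have hn := card_pos.2 hC
  rcases (comparCount_le_card C s).lt_or_eq with hk | hk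
  · have h1 := h4.exists_compar hk h.hac h.ha h.hc
    have h2 := h4.exists_compar hk h.hbc h.hb h.hc
    have h3 := h4.exists_compar hk h.hbd h.hb h.hd
    by_cases hb : Compar s b <;> by_cases hc : Compar s c
    · have ha : ¬ Compar s a := by
        intro ha
        simp only [ha, hb, hc, if_true] at hlt
        split_ifs at hlt <;> omega
      have hd : ¬ Compar s d := by
        intro hd
        simp only [hd, hb, hc, if_true] at hlt
        split_ifs at hlt <;> omega
      exact not_pentagon hb h.hab.symm h.had h.hcd.symm hc.symm ha h.hbd h.hac
        (fun h' => hd h'.symm) fun h' => h.hbc h'.symm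
    · have ha : Compar s a := h1.resolve_right hc
      simp only [ha, hb, hc, if_true, if_false] at hlt
      exact h.not_partial hv h4 hC4 hmin hsa hsb ha hb hc hk hlt
    · have hd : Compar s d := h3.resolve_left hb
      simp only [hd, hb, hc, if_true, if_false] at hlt
      refine h.symm.not_partial hv h4 hC4 hmin hsd hsc hd hc hb hk ?_
      refine lt_of_eq_of_lt ?_ hlt
      ring
    · exact h2.elim hb hc
  · have hall := comparCount_eq_card_iff.1 hk
    have hcost : ∀ x y z w : S, KConfig x y z w C → ¬ Compar s x → ¬ Compar s y → ¬ Compar s z →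
        False := by
      intro x y z w hxy hx hy hz
      have := Triple.le_of_cards hmin (hxy.pair_triple hall hx hy hz)
        (card_insert_of_notMem hsC) (card_pair hxy.ne_ab) (card_singleton z)
      have hlt : (1 : ℝ) / ((#C + 1 : ℕ) + 1) < 1 / (#C + 1) := by
        push_cast
        exact one_div_lt_one_div_of_lt (by positivity) (by linarith)
      norm_num at this hlt
      linarith
    have hA := hcost a b c d h
    have hB := hcost d c b a h.symm
    rw [hk] at hlt
    have hn1 : #C = 1 := by
      by_contra hne
      have h2 : 2 ≤ #C := by omega
      -- Here `k` counts the neighbours on the path, with `b` and `c` counted twice. At most one of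
      -- `a`, `d` could then be met, and `hA`, `hB` exclude this.
      have key : ∀ k : ℕ, (#C + 1) * k + 5 * #C < 5 * (#C + 1) → k ≤ 1 := by
        intro k hk
        by_contra! hk2
        have := Nat.mul_le_mul (Nat.le_refl (#C + 1)) hk2
        omega
      have := key _ hlt
      split_ifs at this <;> first | omega | tauto
    obtain ⟨t, ht⟩ := card_eq_one.1 hn1
    have htC : t ∈ C := ht ▸ mem_singleton_self t
    have hst := hall t htC
    rw [hn1] at hlt hmin
    norm_num at hmin
    by_cases hb : Compar s b
    · have : ¬ Compar s a ∧ ¬ Compar s c ∧ ¬ Compar s d := by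
        simp only [hb, if_true] at hlt
        split_ifs at hlt <;> first | omega | tauto
      exact h.not_pendant hv h4 hmin htC hst this.1 hb this.2.1 this.2.2
    by_cases hc : Compar s c
    · have : ¬ Compar s a ∧ ¬ Compar s d := by
        simp only [hc, if_true] at hlt
        split_ifs at hlt <;> first | omega | tauto
      exact h.symm.not_pendant hv h4 hmin htC hst this.2 hc hb this.1
    have ha : Compar s a := by
      by_contra ha
      exact hA ha hb hc
    have hd : Compar s d := by
      by_contra hd
      exact hB hd hc hb
    -- The triangle is `s, a, d`, with pendant points `t, b, c`.
    exact not_net ha h.had hd.symm hst h.hab h.hcd.symm hb (h.ha t htC) h.hac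
      (fun h' => h.hbd h'.symm) (h.hd t htC) hc

end

end KGrowth

/-! ### Three chains of least cost: the covering case and arithmetic of sizes -/

section WidthThree

set_option linter.unusedSectionVars false
set_option linter.unusedTactic false

variable {S : Type*} [Fintype S] [PartialOrder S]

lemma tripleCost_rotate (A B C : Finset S) : tripleCost B C A = tripleCost A B C := by
  unfold tripleCost; ring

lemma tripleCost_swap (A B C : Finset S) : tripleCost A C B = tripleCost A B C := by
  unfold tripleCost; ring

lemma exists_minCost {A B C : Finset S} (h : Triple A B C) :
    ∃ A B C : Finset S, Triple A B C ∧ MinCost S (tripleCost A B C) := by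
  classical
  obtain ⟨⟨A', B', C'⟩, h1, h2⟩ := exists_min_image
    ({t : Finset S × Finset S × Finset S | Triple t.1 t.2.1 t.2.2} : Finset _)
    (fun t => tripleCost t.1 t.2.1 t.2.2) ⟨(A, B, C), by simpa using h⟩
  exact ⟨A', B', C', by simpa using h1, fun X Y Z hT => h2 (X, Y, Z) (by simpa using hT)⟩

lemma Triple.clique_vec {A B C : Finset S} (h : Triple A B C) (i : Fin 3) :
    Clique (![A, B, C] i) := by
  fin_cases i
  exacts [h.cliqueA, h.cliqueB, h.cliqueC]

lemma Triple.separate_vec {A B C : Finset S} (h : Triple A B C) (i j : Fin 3) (hij : i ≠ j) :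
    Separate (![A, B, C] i) (![A, B, C] j) := by
  fin_cases i <;> fin_cases j
  exacts [absurd rfl hij, h.sepAB, h.sepAC, h.sepAB.symm, absurd rfl hij, h.sepBC, h.sepAC.symm,
    h.sepBC.symm, absurd rfl hij]

lemma Triple.nonempty_vec {A B C : Finset S} (h : Triple A B C) (i : Fin 3) :
    (![A, B, C] i).Nonempty := by
  fin_cases i
  exacts [h.neA, h.neB, h.neC]

lemma div_add_one_eq (n : ℕ) : (n / (n + 1) : ℝ) = 1 - 1 / (n + 1) := by
  field_simp
  ring

lemma UtmostData.triple_cover_or_grow {v : S → ℝ} (hv : UtmostData v) {A B C : Finset S}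
    (h : Triple A B C) :
    ((∀ s, s ∈ A ∨ s ∈ B ∨ s ∈ C) ∧ tripleCost A B C ≤ 1) ∨
      (1 ≤ tripleCost A B C ∧ ∃ s, s ∉ A ∧ s ∉ B ∧ s ∉ C ∧
        (comparCount A s / (#A + 1) + comparCount B s / (#B + 1) +
          comparCount C s / (#C + 1) : ℝ) < 1) := by
  rcases hv.cliques_cover_or_grow ![A, B, C] (by norm_num) h.clique_vec h.separate_vec
    h.nonempty_vec with ⟨h1, h2⟩ | ⟨h2, s, hs, hlt⟩
  · left
    refine ⟨fun s => ?_, ?_⟩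
    · obtain ⟨i, hi⟩ := h1 s
      fin_cases i
      exacts [Or.inl hi, Or.inr (Or.inl hi), Or.inr (Or.inr hi)]
    · simp only [div_add_one_eq, Fin.sum_univ_three] at h2
      unfold tripleCost
      simp at h2 ⊢
      linarith
  · right
    refine ⟨?_, s, hs 0, hs 1, hs 2, ?_⟩
    · simp only [div_add_one_eq, Fin.sum_univ_three] at h2
      unfold tripleCost
      simp at h2 ⊢
      linarith
    · rw [Fin.sum_univ_three] at hlt
      exact hlt

/-- The first inequality says `P ≥ 4`; the second says `P ≤ 4` after a point of the longest chain is
deleted. Together they bound all sizes and leave a finite search. -/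
lemma sorted_sizes {l m n : ℕ} (hl : 1 ≤ l) (hlm : l ≤ m) (hmn : m ≤ n)
    (h1 : (1 / (l + 1) + 1 / (m + 1) + 1 / (n + 1) : ℝ) ≤ 1)
    (h2 : 2 ≤ n → (1 : ℝ) ≤ 1 / (l + 1) + 1 / (m + 1) + 1 / n) :
    (l = 2 ∧ m = 2 ∧ n = 2) ∨ (l = 1 ∧ m = 3 ∧ n = 3) ∨ (l = 1 ∧ m = 2 ∧ n = 5) ∨
      (l = 2 ∧ m = 2 ∧ n = 3) ∨ (l = 1 ∧ m = 3 ∧ n = 4) ∨ (l = 1 ∧ m = 2 ∧ n = 6) := by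
  have inv_le : ∀ {p q : ℕ}, 1 ≤ p → p ≤ q → (1 / q : ℝ) ≤ 1 / p := by
    intro p q hp hpq
    exact one_div_le_one_div_of_le (by exact_mod_cast hp) (by exact_mod_cast hpq)
  have hn2 : 2 ≤ n := by
    by_contra hn
    obtain ⟨rfl, rfl, rfl⟩ : l = 1 ∧ m = 1 ∧ n = 1 := by omega
    norm_num at h1
  have h2 := h2 hn2
  have hl2 : l ≤ 2 := by
    by_contra! hl3
    have a1 := inv_le (p := 4) (q := l + 1) (by norm_num) (by omega)
    have a2 := inv_le (p := 4) (q := m + 1) (by norm_num) (by omega)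
    have a3 := inv_le (p := 3) (q := n) (by norm_num) (by omega)
    push_cast at a1 a2 a3
    linarith
  have hm3 : m ≤ 3 := by
    by_contra! hm4
    have a1 := inv_le (p := 2) (q := l + 1) (by norm_num) (by omega)
    have a2 := inv_le (p := 5) (q := m + 1) (by norm_num) (by omega)
    have a3 := inv_le (p := 4) (q := n) (by norm_num) (by omega)
    push_cast at a1 a2 a3
    linarith
  -- Unless `l = m = 1`, the first two terms of `h2` add up to at most `5/6`, so `1/n` must be at
  -- least `1/6`.
  have hn6 : l + m ≤ 2 ∨ n ≤ 6 := by
    by_contra! hc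
    have a1 : (1 / (l + 1) + 1 / (m + 1) : ℝ) ≤ 5 / 6 := by
      interval_cases l <;> interval_cases m <;> first | omega | norm_num
    have a3 := inv_le (p := 7) (q := n) (by norm_num) (by omega)
    push_cast at a3
    linarith
  rcases hn6 with hn6 | hn6
  · obtain ⟨rfl, rfl⟩ : l = 1 ∧ m = 1 := by omega
    have : (0 : ℝ) < 1 / (n + 1) := by positivity
    norm_num at h1
    norm_num at this
    linarith
  · interval_cases l <;> interval_cases m <;> interval_cases n <;>
    first | omega | (norm_num at h1; done) | (norm_num at h2; done)

lemma UtmostData.triple_cover_of_le {v : S → ℝ} (hv : UtmostData v) {A B C : Finset S}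
    (h : Triple A B C) (hcov : ∀ s, s ∈ A ∨ s ∈ B ∨ s ∈ C) (hcost : tripleCost A B C ≤ 1)
    (hAB : #A ≤ #B) (hBC : #B ≤ #C) : InListI S ∨ InListII S := by
  classical
  have hiso : ∀ {l m n : ℕ}, #A = l → #B = m → #C = n → Nonempty (S ≃o ChainUnion ![l, m, n]) := by
    intro l m n hl hm hn
    refine exists_orderIso_chainUnion ![A, B, C] h.clique_vec h.separate_vec (fun i => ?_)
      fun s => ?_
    · fin_cases i
      exacts [hl, hm, hn]
    · rcases hcov s with h' | h' | h'
      exacts [⟨0, h'⟩, ⟨1, h'⟩, ⟨2, h'⟩]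
  -- With a point of `C` removed the triple no longer covers, so the growth alternative gives cost
  -- at least 1.
  have hsizes := sorted_sizes (card_pos.2 h.neA) hAB hBC hcost fun hC2 => by
    obtain ⟨c, hc⟩ := h.neC
    have hcard := card_erase_of_mem hc
    have h' : Triple A B (C.erase c) :=
      { h with
        cliqueC := h.cliqueC.mono (erase_subset _ _)
        sepAC := h.sepAC.mono subset_rfl (erase_subset _ _)
        sepBC := h.sepBC.mono subset_rfl (erase_subset _ _)
        neC := card_pos.1 (by omega) }
    rcases hv.triple_cover_or_grow h' with ⟨hcov', -⟩ | ⟨h1, -⟩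
    · exfalso
      rcases hcov' c with h1 | h1 | h1
      · exact disjoint_left.1 h.sepAC.disjoint h1 hc
      · exact disjoint_left.1 h.sepBC.disjoint h1 hc
      · exact notMem_erase c C h1
    · rw [tripleCost, hcard, Nat.cast_sub (by omega)] at h1
      simpa using h1
  rcases hsizes with ⟨h1, h2, h3⟩ | ⟨h1, h2, h3⟩ | ⟨h1, h2, h3⟩ | ⟨h1, h2, h3⟩ | ⟨h1, h2, h3⟩ |
    ⟨h1, h2, h3⟩ <;> have := hiso h1 h2 h3 <;> unfold InListI InListII <;> tauto

lemma UtmostData.triple_cover {v : S → ℝ} (hv : UtmostData v) {A B C : Finset S}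
    (h : Triple A B C) (hcov : ∀ s, s ∈ A ∨ s ∈ B ∨ s ∈ C) (hcost : tripleCost A B C ≤ 1) :
    InListI S ∨ InListII S := by
  have c1 : tripleCost B C A ≤ 1 := by rwa [tripleCost_rotate]
  have c2 : tripleCost C A B ≤ 1 := by rwa [tripleCost_rotate, tripleCost_rotate]
  have c3 : tripleCost A C B ≤ 1 := by rwa [tripleCost_swap]
  have c4 : tripleCost B A C ≤ 1 := by rwa [tripleCost_swap]
  have c5 : tripleCost C B A ≤ 1 := by rwa [tripleCost_swap]
  rcases le_total #A #B with h1 | h1 <;> rcases le_total #B #C with h2 | h2 <;>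
    rcases le_total #A #C with h3 | h3
  · exact hv.triple_cover_of_le h hcov hcost h1 h2
  · exact hv.triple_cover_of_le h hcov hcost h1 h2
  · exact hv.triple_cover_of_le h.swap (fun s => by have := hcov s; tauto) c3 h3 h2
  · exact hv.triple_cover_of_le h.rotate.rotate (fun s => by have := hcov s; tauto) c2 h3 h1
  · exact hv.triple_cover_of_le h.rotate.swap (fun s => by have := hcov s; tauto) c4 h1 h3
  · exact hv.triple_cover_of_le h.rotate (fun s => by have := hcov s; tauto) c1 h2 h3
  · exact hv.triple_cover_of_le h.rotate.rotate.swap (fun s => by have := hcov s; tauto) c5 h2 h1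
  · exact hv.triple_cover_of_le h.rotate.rotate.swap (fun s => by have := hcov s; tauto) c5 h2 h1

/-- With `m = #A + 1` and `n = #B + 1`, lengthening `A` by one point at the expense of `k` points of
`B` does not lower the cost only when it interchanges the two sizes. -/
lemma exchange_sizes {m n k : ℕ} (hm : 2 ≤ m) (hk : 1 ≤ k) (h : k * m < n)
    (hcost : (1 / m + 1 / n : ℝ) ≤ 1 / (m + 1) + 1 / (n - k)) : k = 1 ∧ n = m + 1 := by
  have hkn : k < n := lt_of_le_of_lt (Nat.le_mul_of_pos_right k (by omega)) h
  have hm' : (2 : ℝ) ≤ m := by exact_mod_cast hm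
  have hk' : (1 : ℝ) ≤ k := by exact_mod_cast hk
  have hn' : (k : ℝ) < n := by exact_mod_cast hkn
  have hn0 : (0 : ℝ) < n := by linarith
  have e1 : (1 / m - 1 / (m + 1) : ℝ) = 1 / (m * (m + 1)) := by
    field_simp
    ring
  have e2 : (1 / (n - k) - 1 / n : ℝ) = k / (n * (n - k)) := by
    have : (n - k : ℝ) ≠ 0 := by linarith
    field_simp
    ring
  have h1 : (1 / (m * (m + 1)) : ℝ) ≤ k / (n * (n - k)) := by linarith
  rw [div_le_div_iff₀ (by positivity) (mul_pos hn0 (by linarith)), one_mul] at h1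
  -- In terms of the excess `e` the inequality bounds a sum of two nonnegative products by zero,
  -- forcing `k = 1` and `e = 0`.
  obtain ⟨e, rfl⟩ : ∃ e, n = k * m + 1 + e := ⟨n - (k * m + 1), by omega⟩
  push_cast at h1
  have he : (0 : ℝ) ≤ e := Nat.cast_nonneg e
  have key : (k - 1 : ℝ) * (k * m ^ 2 - k * m - 1) + e * (2 * (k * m + 1) - k + e) ≤ 0 := by
    nlinarith
  have hkm : (2 : ℝ) ≤ k * m := by nlinarith
  have hp1 : (0 : ℝ) < k * m ^ 2 - k * m - 1 := by
    nlinarith [mul_nonneg (sub_nonneg.2 hkm) (by linarith : (0 : ℝ) ≤ m - 1)]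
  have hp2 : (0 : ℝ) < 2 * (k * m + 1) - k + e := by nlinarith
  have t1 : (0 : ℝ) ≤ (k - 1 : ℝ) * (k * m ^ 2 - k * m - 1) := mul_nonneg (by linarith) hp1.le
  have t2 : (0 : ℝ) ≤ e * (2 * (k * m + 1) - k + e) := mul_nonneg he hp2.le
  have z1 : (k - 1 : ℝ) = 0 :=
    (mul_eq_zero.1 (by linarith : (k - 1 : ℝ) * (k * m ^ 2 - k * m - 1) = 0)).resolve_right hp1.ne'
  have z2 : (e : ℝ) = 0 :=
    (mul_eq_zero.1 (by linarith : (e : ℝ) * (2 * (k * m + 1) - k + e) = 0)).resolve_right hp2.ne'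
  have k1 : k = 1 := by exact_mod_cast (by linarith : (k : ℝ) = 1)
  have e0 : e = 0 := by exact_mod_cast z2
  subst k1 e0
  omega

end WidthThree

/-! ### The growing case and the classification -/

section Classification

set_option linter.unusedSectionVars false

variable {S : Type*} [Fintype S] [PartialOrder S]

/-- The triangles are `A ∪ {s}` and `B`, joined by the edge from `s` to `e`, and `C` is the isolated
point. -/
lemma UtmostData.triangles_case {v : S → ℝ} (hv : UtmostData v) (h4 : NoFour S)
    {A B C : Finset S} (h : Triple A B C) (hmin : MinCost S (tripleCost A B C)) {s e : S}
    (hsA : s ∉ A) (hsB : s ∉ B) (hfull : ∀ a ∈ A, Compar s a) (hsC : Apart s C)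
    (he : e ∈ B) (hse : Compar s e) (hB : ∀ t ∈ B, t ≠ e → ¬ Compar s t)
    (hA2 : #A = 2) (hB3 : #B = 3) (hC1 : #C = 1) : False := by
  classical
  have hcost : tripleCost A B C = 13 / 12 := by
    rw [tripleCost, hA2, hB3, hC1]; norm_num
  rw [hcost] at hmin
  obtain ⟨a₀, a₁, ha01, rfl⟩ := card_eq_two.1 hA2
  obtain ⟨f, g, hfg, hBe⟩ := card_eq_two.1 (by rw [card_erase_of_mem he, hB3] : #(B.erase e) = 2)
  obtain ⟨c, rfl⟩ := card_eq_one.1 hC1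
  have hf : f ∈ B ∧ f ≠ e := by
    have : f ∈ B.erase e := by rw [hBe]; simp
    exact ⟨mem_of_mem_erase this, ne_of_mem_erase this⟩
  have hg : g ∈ B ∧ g ≠ e := by
    have : g ∈ B.erase e := by rw [hBe]; simp
    exact ⟨mem_of_mem_erase this, ne_of_mem_erase this⟩
  have ma0 : a₀ ∈ ({a₀, a₁} : Finset S) := by simp
  have ma1 : a₁ ∈ ({a₀, a₁} : Finset S) := by simp
  have mc : c ∈ ({c} : Finset S) := by simp
  have b1 := h.cliqueA a₀ ma0 a₁ ma1
  have b2 := (hfull a₀ ma0).symm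
  have b3 := (hfull a₁ ma1).symm
  have b4 := h.sepAB a₀ ma0 e he
  have b5 := h.sepAB a₀ ma0 f hf.1
  have b6 := h.sepAB a₀ ma0 g hg.1
  have b7 := h.sepAC a₀ ma0 c mc
  have c4 := h.sepAB a₁ ma1 e he
  have c5 := h.sepAB a₁ ma1 f hf.1
  have c6 := h.sepAB a₁ ma1 g hg.1
  have c7 := h.sepAC a₁ ma1 c mc
  have d5 := hB f hf.1 hf.2
  have d6 := hB g hg.1 hg.2
  have d7 := hsC c mc
  have e5 := h.cliqueB e he f hf.1
  have e6 := h.cliqueB e he g hg.1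
  have e7 := h.sepBC e he c mc
  have f6 := h.cliqueB f hf.1 g hg.1
  have f7 := h.sepBC f hf.1 c mc
  have g7 := h.sepBC g hg.1 c mc
  have n1 : a₀ ≠ s := fun h' => hsA (h' ▸ ma0)
  have n2 : a₁ ≠ s := fun h' => hsA (h' ▸ ma1)
  have n3 : s ≠ e := fun h' => hsB (h' ▸ he)
  have n4 : e ≠ f := hf.2.symm
  have n5 : e ≠ g := hg.2.symm
  have hx : ∀ i j, Compar ((![a₀, a₁, s, e, f, g, c] : Fin 7 → S) i)
      ((![a₀, a₁, s, e, f, g, c] : Fin 7 → S) j) ↔ trianglesAdj i j := by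
    refine compar_iff_of_lt _ _ (by decide) (by decide) fun i j hij => ?_
    fin_cases i <;> fin_cases j <;>
    first
    | exact absurd hij (by decide)
    | exact iff_of_true (by assumption) (by decide)
    | exact iff_of_false (by assumption) (by decide)
  have hne : ∀ i j : Fin 7, i < j → (![a₀, a₁, s, e, f, g, c] : Fin 7 → S) i ≠
      (![a₀, a₁, s, e, f, g, c] : Fin 7 → S) j := by
    intro i j hij
    by_cases hadj : trianglesAdj i j
    · fin_cases i <;> fin_cases j <;>
      first
      | exact absurd hij (by decide)
      | exact absurd hadj (by decide)
      | assumption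
    · exact fun h' => hadj ((hx i j).1 (h' ▸ Compar.refl _))
  refine hv.not_triangles h4 hmin (fun x y z w D hD hD3 => ?_) ![a₀, a₁, s, e, f, g, c] ?_ hx
  -- The minimum `13/12 = 1/2 + 1/3 + 1/4` is exactly the cost required by `KConfig.cover` for a
  -- three-element chain, and that lemma would then give at least four elements.
  · have := (hD.cover hv h4 (card_pos.1 (by omega)) (by rw [hD3]; norm_num; exact hmin)).2
    omega
  · intro i j hij
    rcases lt_trichotomy i j with h' | h' | h'
    exacts [absurd hij (hne i j h'), h', absurd hij.symm (hne j i h')]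

/-- The four-point path is `x, s, e, f`, with `A = {x}` and `B = {e, f}`. -/
lemma UtmostData.kWithChain_case {v : S → ℝ} (hv : UtmostData v) (h4 : NoFour S)
    {A B C : Finset S} (h : Triple A B C) (hmin : MinCost S (tripleCost A B C)) {s e : S}
    (hfull : ∀ a ∈ A, Compar s a) (hsC : Apart s C)
    (he : e ∈ B) (hse : Compar s e) (hB : ∀ t ∈ B, t ≠ e → ¬ Compar s t)
    (hA1 : #A = 1) (hB2 : #B = 2) (hC5 : #C ≤ 5) :
    Nonempty (S ≃o KWithChain 4) ∨ Nonempty (S ≃o KWithChain 5) := by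
  classical
  have hcost : tripleCost A B C = 1 / 2 + 1 / 3 + 1 / (#C + 1) := by
    rw [tripleCost, hA1, hB2]; norm_num
  rw [hcost] at hmin
  obtain ⟨x, rfl⟩ := card_eq_one.1 hA1
  obtain ⟨f, hBe⟩ := card_eq_one.1 (by rw [card_erase_of_mem he, hB2] : #(B.erase e) = 1)
  have hf : f ∈ B ∧ f ≠ e := by
    have : f ∈ B.erase e := by rw [hBe]; simp
    exact ⟨mem_of_mem_erase this, ne_of_mem_erase this⟩
  have hK : KConfig s x f e C :=
    { hab := hfull x (mem_singleton_self x)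
      hcd := h.cliqueB f hf.1 e he
      had := hse
      hac := hB f hf.1 hf.2
      hbc := h.sepAB x (mem_singleton_self x) f hf.1
      hbd := h.sepAB x (mem_singleton_self x) e he
      clique := h.cliqueC
      ha := hsC
      hb := h.sepAC x (mem_singleton_self x)
      hc := h.sepBC f hf.1
      hd := h.sepBC e he }
  obtain ⟨hcov, hC4⟩ := hK.cover hv h4 h.neC hmin
  obtain hC | hC : #C = 4 ∨ #C = 5 := by omega
  · exact Or.inl (hK.exists_orderIso hC hcov)
  · exact Or.inr (hK.exists_orderIso hC hcov)

/-- The sizes left by `exchange_sizes` (with `m = #A + 1`, `n = #B + 1`) are cut down to finitely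
many by cost at least 1. -/
lemma neighbour_sizes {n c : ℕ} {m : ℕ} (hm : 2 ≤ m) (hn : n = m + 1) (hc : 1 ≤ c)
    (hcost : (1 : ℝ) ≤ 1 / m + 1 / n + 1 / (c + 1)) :
    (m = 2 ∧ c ≤ 5) ∨ (m = 3 ∧ c = 1) := by
  subst hn
  have inv_le : ∀ {p q : ℕ}, 1 ≤ p → p ≤ q → (1 / q : ℝ) ≤ 1 / p := by
    intro p q hp hpq
    exact one_div_le_one_div_of_le (by exact_mod_cast hp) (by exact_mod_cast hpq)
  push_cast at hcost
  have hm3 : m ≤ 3 := by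
    by_contra! hm4
    have a1 := inv_le (p := 4) (q := m) (by norm_num) (by omega)
    have a2 := inv_le (p := 5) (q := m + 1) (by norm_num) (by omega)
    have a3 := inv_le (p := 2) (q := c + 1) (by norm_num) (by omega)
    push_cast at a1 a2 a3
    linarith
  obtain rfl | rfl : m = 2 ∨ m = 3 := by omega
  · left
    refine ⟨rfl, ?_⟩
    by_contra! hc6
    have a3 := inv_le (p := 7) (q := c + 1) (by norm_num) (by omega)
    push_cast at a3
    norm_num at hcost a3
    linarith
  · right
    refine ⟨rfl, ?_⟩
    by_contra hc1
    have a3 := inv_le (p := 3) (q := c + 1) (by norm_num) (by omega)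
    push_cast at a3
    norm_num at hcost a3
    linarith

open Classical in
lemma UtmostData.full_apart_case {v : S → ℝ} (hv : UtmostData v) (h4 : NoFour S)
    {A B C : Finset S} (h : Triple A B C) (hmin : MinCost S (tripleCost A B C))
    (hcost : 1 ≤ tripleCost A B C) {s : S} (hsA : s ∉ A) (hsB : s ∉ B)
    (hfull : ∀ a ∈ A, Compar s a) (hsC : Apart s C)
    (hlt : (#A / (#A + 1) + comparCount B s / (#B + 1) : ℝ) < 1) :
    Nonempty (S ≃o KWithChain 4) ∨ Nonempty (S ≃o KWithChain 5) := by
  set k := comparCount B s with hk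
  have hA := card_pos.2 h.neA
  have hlt' : k * (#A + 1) < #B + 1 := by
    have hp : (0 : ℝ) < #A + 1 := by positivity
    have hq : (0 : ℝ) < #B + 1 := by positivity
    have h1 : (k / (#B + 1) : ℝ) < 1 / (#A + 1) := by
      rw [div_add_one_eq] at hlt
      linarith
    rw [div_lt_div_iff₀ hq hp, one_mul] at h1
    exact_mod_cast h1
  set D := {t ∈ B | ¬ Compar s t} with hD
  have hDB : D ⊆ B := filter_subset _ _
  have hDcard : #D + k = #B := by
    rw [hk, comparCount, hD, add_comm]
    exact card_filter_add_card_filter_not _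
  have hDpos : 0 < #D := by
    have hB := card_pos.2 h.neB
    have := Nat.mul_le_mul_left k (by omega : 2 ≤ #A + 1)
    omega
  have hsD : Apart s D := fun t ht => (mem_filter.1 ht).2
  have hT : Triple (insert s A) D C :=
    { cliqueA := h.cliqueA.insert hfull
      cliqueB := h.cliqueB.mono hDB
      cliqueC := h.cliqueC
      sepAB := Apart.insert_left hsD (h.sepAB.mono subset_rfl hDB)
      sepAC := Apart.insert_left hsC h.sepAC
      sepBC := h.sepBC.mono hDB subset_rfl
      neA := insert_nonempty _ _
      neB := card_pos.1 hDpos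
      neC := h.neC }
  -- Minimality is tested against the triple in which `s` joins `A` and its `k` neighbours leave
  -- `B`.
  have hcmp := hmin _ _ _ hT
  unfold tripleCost at hcmp
  rw [card_insert_of_notMem hsA] at hcmp
  have hDreal : (#D : ℝ) = #B - k := by
    rw [← hDcard]; push_cast; ring
  have hcmp' : (1 / ((#A + 1 : ℕ) : ℝ) + 1 / ((#B + 1 : ℕ) : ℝ) : ℝ) ≤
      1 / (((#A + 1 : ℕ) : ℝ) + 1) + 1 / (((#B + 1 : ℕ) : ℝ) - k) := by
    have e : ((#B + 1 : ℕ) : ℝ) - k = #D + 1 := by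
      rw [hDreal]; push_cast; ring
    rw [e]
    push_cast at hcmp ⊢
    linarith
  have hk1 : 1 ≤ k := by
    by_contra hk0
    have hk0 : k = 0 := by omega
    rw [hk0] at hcmp'
    push_cast at hcmp'
    have : (1 : ℝ) / ((#A : ℝ) + 1 + 1) < 1 / (#A + 1) :=
      one_div_lt_one_div_of_lt (by positivity) (by linarith)
    rw [sub_zero] at hcmp'
    linarith
  obtain ⟨hk1, hBA⟩ := exchange_sizes (by omega) hk1 hlt' hcmp'
  obtain ⟨e, heB⟩ := card_eq_one.1 hk1
  have he : e ∈ B ∧ Compar s e := by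
    have : e ∈ ({t ∈ B | Compar s t} : Finset S) := heB ▸ mem_singleton_self e
    simpa using this
  have hne : ∀ t ∈ B, t ≠ e → ¬ Compar s t := by
    intro t ht hte hst
    have : t ∈ ({t ∈ B | Compar s t} : Finset S) := by simp [ht, hst]
    rw [heB, mem_singleton] at this
    exact hte this
  rcases neighbour_sizes (m := #A + 1) (by omega) hBA (card_pos.2 h.neC) (by
    unfold tripleCost at hcost
    push_cast
    exact hcost) with ⟨h1, h2⟩ | ⟨h1, h2⟩
  · exact hv.kWithChain_case h4 h hmin hfull hsC he.1 he.2 hne (by omega) (by omega) h2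
  · exact (hv.triangles_case h4 h hmin hsA hsB hfull hsC he.1 he.2 hne (by omega) (by omega)
      h2).elim

lemma UtmostData.full_case {v : S → ℝ} (hv : UtmostData v) (h4 : NoFour S)
    {A B C : Finset S} (h : Triple A B C) (hmin : MinCost S (tripleCost A B C))
    (hcost : 1 ≤ tripleCost A B C) {s : S} (hsA : s ∉ A) (hsB : s ∉ B) (hsC : s ∉ C)
    (hfull : comparCount A s = #A)
    (hlt : (comparCount A s / (#A + 1) + comparCount B s / (#B + 1) +
      comparCount C s / (#C + 1) : ℝ) < 1) :
    Nonempty (S ≃o KWithChain 4) ∨ Nonempty (S ≃o KWithChain 5) := by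
  have hfull' := comparCount_eq_card_iff.1 hfull
  rw [hfull] at hlt
  rcases Nat.eq_zero_or_pos (comparCount C s) with hC | hC
  · refine hv.full_apart_case h4 h hmin hcost hsA hsB hfull' (comparCount_eq_zero_iff.1 hC) ?_
    simpa [hC] using hlt
  rcases Nat.eq_zero_or_pos (comparCount B s) with hB | hB
  · refine hv.full_apart_case h4 h.swap (by rwa [tripleCost_swap]) (by rwa [tripleCost_swap]) hsA
      hsC hfull' (comparCount_eq_zero_iff.1 hB) ?_
    simpa [hB] using hlt
  exfalso
  -- If `s` met both `B` and `C`, then `1/(#B+1) + 1/(#C+1) < 1/(#A+1)`, so the cost would be below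
  -- `2/(#A+1) ≤ 1`.
  have hB' : (1 / (#B + 1) : ℝ) ≤ comparCount B s / (#B + 1) :=
    div_le_div_of_nonneg_right (by exact_mod_cast hB) (by positivity)
  have hC' : (1 / (#C + 1) : ℝ) ≤ comparCount C s / (#C + 1) :=
    div_le_div_of_nonneg_right (by exact_mod_cast hC) (by positivity)
  have hA' : (1 / (#A + 1) : ℝ) ≤ 1 / 2 := by
    have := card_pos.2 h.neA
    exact one_div_le_one_div_of_le (by norm_num) (by
      have : (1 : ℝ) ≤ #A := by exact_mod_cast this
      linarith)
  unfold tripleCost at hcost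
  rw [div_add_one_eq] at hlt
  linarith

/-- An utmost poset without four-element antichains is in one of the lists. -/
theorem UtmostData.of_noFour {v : S → ℝ} (hv : UtmostData v) (h4 : NoFour S) :
    InListI S ∨ InListII S := by
  obtain ⟨a, b, c, hab, hac, hbc⟩ := hv.exists_antichain_three
  obtain ⟨A, B, C, h, hmin⟩ := exists_minCost (S := S) (A := {a}) (B := {b}) (C := {c})
    ⟨clique_singleton a, clique_singleton b, clique_singleton c,
      by simpa [Separate, Apart] using hab, by simpa [Separate, Apart] using hac,
      by simpa [Separate, Apart] using hbc, singleton_nonempty _, singleton_nonempty _,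
      singleton_nonempty _⟩
  rcases hv.triple_cover_or_grow h with ⟨hcov, hcost⟩ | ⟨hcost, s, hsA, hsB, hsC, hlt⟩
  · exact hv.triple_cover h hcov hcost
  suffices hK : Nonempty (S ≃o KWithChain 4) ∨ Nonempty (S ≃o KWithChain 5) by
    unfold InListI InListII
    tauto
  by_cases hA : comparCount A s = #A
  · exact hv.full_case h4 h hmin hcost hsA hsB hsC hA hlt
  by_cases hB : comparCount B s = #B
  · exact hv.full_case h4 h.rotate (by rwa [tripleCost_rotate]) (by rwa [tripleCost_rotate]) hsB hsC
      hsA hB (by linarith)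
  by_cases hC : comparCount C s = #C
  · exact hv.full_case h4 h.rotate.rotate (by rwa [tripleCost_rotate, tripleCost_rotate])
      (by rwa [tripleCost_rotate, tripleCost_rotate]) hsC hsA hsB hC (by linarith)
  -- If `s` missed a point of each chain, these three points and `s` would be a four-element
  -- antichain.
  exfalso
  rw [comparCount_eq_card_iff] at hA hB hC
  push Not at hA hB hC
  obtain ⟨x, hx, hsx⟩ := hA
  obtain ⟨y, hy, hsy⟩ := hB
  obtain ⟨z, hz, hsz⟩ := hC
  exact h.sepBC y hy z hz (h4 s x y z hsx hsy hsz (h.sepAB x hx y hy) (h.sepAC x hx z hz))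

theorem inList_of_utmost (h : Utmost S) : InListI S ∨ InListII S := by
  obtain ⟨v, hv⟩ := exists_utmostData h
  by_cases h5 : ∃ y : Fin 5 → S, ∀ i j, i ≠ j → ¬ Compar (y i) (y j)
  · obtain ⟨y, hy⟩ := h5
    exact Or.inr (Or.inl (hv.of_antichain_five y hy))
  push Not at h5
  by_cases h4 : NoFour S
  · exact hv.of_noFour h4
  unfold NoFour at h4
  push Not at h4
  obtain ⟨a, b, c, d, hab, hac, had, hbc, hbd, hcd⟩ := h4
  have hx : ∀ i j, i ≠ j → ¬ Compar ((![a, b, c, d] : Fin 4 → S) i)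
      ((![a, b, c, d] : Fin 4 → S) j) := by
    intro i j hij hc
    refine hij (((compar_iff_of_lt ![a, b, c, d] (fun i j => i = j) (by decide) (by decide)
      fun i j hij => iff_of_false ?_ hij.ne) i j).1 hc)
    fin_cases i <;> fin_cases j <;> first | exact absurd hij (by decide) | assumption
  rcases hv.of_antichain_four _ hx (fun y hy => by
    obtain ⟨i, j, hij, hc⟩ := h5 y
    exact hy i j hij hc) with h | h
  · exact Or.inl (Or.inl h)
  · exact Or.inr (Or.inr (Or.inl h))

end Classification

end PosetNorm

theorem proposition9 {S : Type*} [Fintype S] [PartialOrder S] :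
    (Utmost S ↔ InListI S ∨ InListII S) ∧
      (Utmost S → ¬ Primitive S →
        Nonempty (S ≃o KWithChain 4) ∨ Nonempty (S ≃o KWithChain 5)) := by
  refine ⟨⟨PosetNorm.inList_of_utmost, PosetNorm.utmost_of_inList⟩, fun h hprim => ?_⟩
  have key : ∀ {p : ℕ} {n : Fin p → ℕ}, ¬ Nonempty (S ≃o ChainUnion n) := fun h' =>
    hprim ⟨_, _, h'⟩
  have hlist := PosetNorm.inList_of_utmost h
  simpa only [InListI, InListII, key, false_or] using hlist
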